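/- Let $V:\mathbb R^2\to\mathbb R$ be of class $C^1$ and non-negative, with $|V(x)|+|x\cdot\nabla V(x)|\le c\,\langle x\rangle^{-\beta}$ for some $c>0$, $\beta>3$, where $\langle x\rangle=(1+|x|^2)^{1/2}$. Let $\Delta_V=\Delta-V$, so that $-\Delta_V$ is a non-negative self-adjoint operator in $L^2(\mathbb R^2)$ with domain $H^2(\mathbb R^2)$ and its powers are defined by the spectral theorem. For $s>0$ and $t>0$ let $M(t)$ be multiplication by $e^{-i|x|^2/(2t)}$ and put $$|J_V|^s(t)=M(-t)(-t^2\Delta_V)^{s/2}M(t),\qquad A(s)=s(-\Delta_V)^{s/2}+\big[x\cdot\nabla,(-\Delta_V)^{s/2}\big],$$ where $[B,D]=BD-DB$. Then, for every $s>0$, $$\Big[i\partial_t+\tfrac12\Delta_V,\ |J_V|^s(t)\Big]=i\,t^{s-1}M(-t)A(s)M(t)$$ in the following sense. Let $I\subseteq(0,\infty)$ be open and let $u\in L^1_{\rm loc}(I;L^2(\mathbb R^2))$ be such that - $F:=(i\partial_t+\frac12\Delta_V)u$, taken in the sense of distributions, is in $L^1_{\rm loc}(I;L^2(\mathbb R^2))$;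 - $M(t)u(t)$ is in the domain of $(-t^2\Delta_V)^{s/2}$ for a.e. $t\in I$, and $|J_V|^su\in L^1_{\rm loc}(I;L^2(\mathbb R^2))$; - $x\cdot\nabla(M(t)u(t))\in L^2(\mathbb R^2)$ for a.e. $t\in I$, and $x\cdot\nabla(Mu)\in L^1_{\rm loc}(I;L^2(\mathbb R^2))$; - for a.e. $t\in I$ the functions $(1-\Delta_V)^{-1}M(t)F(t)$ and $(1-\Delta_V)^{-1}\,x\cdot\nabla(M(t)u(t))$ are in the domains of $(-t^2\Delta_V)^{s/2}$ and $(-\Delta_V)^{s/2}$ respectively, and their images under these operators are in $L^1_{\rm loc}(I;L^2(\mathbb R^2))$ (for $s\le 2$ this holds automatically). Then $$\Big(i\partial_t+\tfrac12\Delta_V\Big)\big(|J_V|^su\big)-|J_V|^sF=i\,t^{s-1}M(-t)A(s)M(t)u$$ as distributions on $I$ with values in $\mathcal S'(\mathbb R^2)$. Here the two terms $|J_V|^s F$ and $i\,t^{s-1}M(-t)A(s)M(t)u$ are $\mathcal S'(\mathbb R^2)$-valued functions of $t\in I$ whose pairings with each Schwartz function are locally integrable on $I$. In the terms $|J_V|^sF$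 and $(-\Delta_V)^{s/2}\,x\cdot\nabla(M(t)u)$, where the power $B=(-t^2\Delta_V)^{s/2}$ or $B=(-\Delta_V)^{s/2}$ is applied to a function $f\in L^2(\mathbb R^2)$ that need not be in its domain, $Bf$ means the tempered distribution $(1-\Delta_V)\,B(1-\Delta_V)^{-1}f$, which is $Bf$ in the usual sense if $f\in D(B)$; the outer derivatives $x\cdot\nabla$ and $\Delta$ are distributional. -/

import Mathlib

open MeasureTheory Set
open scoped SchwartzMap ContDiff Laplacian LineDeriv

noncomputable section

/-- The plane `ℝ²` with its Euclidean structure. -/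
abbrev Plane : Type := EuclideanSpace ℝ (Fin 2)

/-- The complex Hilbert space `L²(ℝ²)`. -/
abbrev L2 : Type := Lp ℂ 2 (volume : Measure Plane)

/-! ### Partially defined operators

`X →ₗ.[ℂ] Y` is the type of linear operators from a subspace (the domain) of `X` to `Y`. -/

section Partial

variable {X Y Z : Type*} [AddCommGroup X] [Module ℂ X] [AddCommGroup Y] [Module ℂ Y]
  [AddCommGroup Z] [Module ℂ Z]

open Classical in
/-- The value `B f` of a partially defined operator, `0` if `f` is not in the domain of `B`. -/
def pApply (B : X →ₗ.[ℂ] Y) (f : X) : Y := if h : f ∈ B.domain then B ⟨f, h⟩ else 0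

/-- The product `B D` of two partially defined operators, with its natural domain
`{f ∈ D(D) : D f ∈ D(B)}`. -/
def pComp (B : Y →ₗ.[ℂ] Z) (D : X →ₗ.[ℂ] Y) : X →ₗ.[ℂ] Z where
  domain := (B.domain.comap D.toFun).map D.domain.subtype
  toFun :=
    { toFun := fun f => B ⟨D ⟨f.1, by
          obtain ⟨g, -, hg⟩ := f.2
          rw [← hg]; exact g.2⟩, by
          obtain ⟨f, g, hg, rfl⟩ := f
          exact hg⟩
      map_add' := fun f g => by
        rw [← LinearPMap.map_add]
        congr 1
        apply Subtype.ext
        exact D.map_add ⟨f.1, _⟩ ⟨g.1, _⟩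
      map_smul' := fun c f => by
        rw [RingHom.id_apply, ← LinearPMap.map_smul]
        congr 1
        apply Subtype.ext
        exact D.map_smul c ⟨f.1, _⟩ }

/-- An everywhere defined linear map, as a partially defined one. -/
def everywhere (D : X →ₗ[ℂ] Y) : X →ₗ.[ℂ] Y := D.toPMap ⊤

end Partial

/-! ### Real powers of nonnegative self-adjoint operators -/

section Powers

variable {H : Type*} [NormedAddCommGroup H] [InnerProductSpace ℂ H] [CompleteSpace H]

open Classical in
/-- `(1 + T)⁻¹` as a bounded operator on the Hilbert space `H` (`0` if `1 + T` has no bounded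
inverse). Here `(g, h) ∈ T.graph` means `g ∈ D(T)` and `T g = h`; so the condition says that
`R f = g` if and only if `g ∈ D(T)` and `g + T g = f`. -/
def resolventOne (T : H →ₗ.[ℂ] H) : H →L[ℂ] H :=
  if h : ∃ R : H →L[ℂ] H, ∀ f g : H, R f = g ↔ (g, f - g) ∈ T.graph then h.choose else 0

/-- The power `T ^ a`, `a ≥ 0`, of a nonnegative self-adjoint operator `T` on `H`, in the sense of
the spectral theorem. With `R = (1 + T)⁻¹` one has `0 ≤ R ≤ 1`, `T = (1 - R) R⁻¹`, hence
`T ^ a = (1 - R) ^ a (R ^ a)⁻¹` with domain `D(T ^ a) = Ran (R ^ a)`: the graph of `T ^ a` is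
`{(R ^ a f, (1 - R) ^ a f) : f ∈ H}`. The powers of the bounded self-adjoint operators `R` and
`1 - R` are given by the continuous functional calculus. -/
def opPow (T : H →ₗ.[ℂ] H) (a : ℝ) : H →ₗ.[ℂ] H :=
  (LinearMap.range
    (((cfc (fun x : ℝ => x ^ a) (resolventOne T)).prod
      (cfc (fun x : ℝ => (1 - x) ^ a) (resolventOne T)) : H →L[ℂ] H × H) :
        H →ₗ[ℂ] H × H)).toLinearPMap

end Powers

/-! ### The operators on `ℝ²` -/

/-- The embedding of `L²(ℝ²)` into the tempered distributions. -/
def toDist : L2 →ₗ[ℂ] 𝓢'(Plane, ℂ) :=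
  (Lp.toTemperedDistributionCLM ℂ (volume : Measure Plane) 2 : L2 →L[ℂ] 𝓢'(Plane, ℂ))

/-- Multiplication by the function `m` in `L²(ℝ²)`, with domain `{f ∈ L² : m f ∈ L²}`: its graph is
`{(f, h) ∈ L² × L² : h = m f almost everywhere}`. -/
def mulOp (m : Plane → ℂ) : L2 →ₗ.[ℂ] L2 :=
  Submodule.toLinearPMap
    { carrier := {p : L2 × L2 | ∀ᵐ x : Plane, p.2 x = m x * p.1 x}
      add_mem' := fun {p q} hp hq => by
        filter_upwards [hp, hq, Lp.coeFn_add p.1 q.1, Lp.coeFn_add p.2 q.2] with x h1 h2 h3 h4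
        rw [Prod.fst_add, Prod.snd_add, h3, h4, Pi.add_apply, Pi.add_apply, h1, h2, mul_add]
      zero_mem' := by
        filter_upwards [Lp.coeFn_zero ℂ 2 (volume : Measure Plane)] with x h
        rw [Prod.fst_zero, Prod.snd_zero, h, Pi.zero_apply, mul_zero]
      smul_mem' := fun c p hp => by
        filter_upwards [hp, Lp.coeFn_smul c p.1, Lp.coeFn_smul c p.2] with x h1 h2 h3
        rw [Prod.smul_fst, Prod.smul_snd, h2, h3, Pi.smul_apply, Pi.smul_apply, h1,
          smul_eq_mul, smul_eq_mul, mul_left_comm] }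

/-- The realization in `L²(ℝ²)`, on the maximal domain `{f ∈ L² : D f ∈ L²}`, of a linear operator
`D` on tempered distributions: its graph is `{(f, h) ∈ L² × L² : D f = h}`. -/
def l2Part (D : 𝓢'(Plane, ℂ) →ₗ[ℂ] 𝓢'(Plane, ℂ)) : L2 →ₗ.[ℂ] L2 :=
  (LinearMap.eqLocus (D ∘ₗ toDist ∘ₗ LinearMap.fst ℂ L2 L2)
    (toDist ∘ₗ LinearMap.snd ℂ L2 L2)).toLinearPMap

/-- The Laplacian `Δ` on tempered distributions. -/
def lapDist : 𝓢'(Plane, ℂ) →ₗ[ℂ] 𝓢'(Plane, ℂ) :=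
  (LineDeriv.laplacianCLM ℂ Plane 𝓢'(Plane, ℂ) : 𝓢'(Plane, ℂ) →L[ℂ] 𝓢'(Plane, ℂ))

/-- The operator `x · ∇ = x₁ ∂₁ + x₂ ∂₂` on tempered distributions. -/
def eulerDist : 𝓢'(Plane, ℂ) →ₗ[ℂ] 𝓢'(Plane, ℂ) :=
  (∑ j : Fin 2, (TemperedDistribution.smulLeftCLM ℂ (fun x : Plane => ((x j : ℝ) : ℂ))) ∘L
    (LineDeriv.lineDerivOpCLM ℂ 𝓢'(Plane, ℂ) (EuclideanSpace.single j (1 : ℝ))) :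
      𝓢'(Plane, ℂ) →L[ℂ] 𝓢'(Plane, ℂ))

/-- `Δ_V = Δ - V` in `L²(ℝ²)`, with domain `{f ∈ L² : Δ f ∈ L², V f ∈ L²}`, which is `H²(ℝ²)` for
bounded `V`. -/
def deltaV (V : Plane → ℝ) : L2 →ₗ.[ℂ] L2 := l2Part lapDist - mulOp (fun x => (V x : ℂ))

/-- `Δ_V = Δ - V` acting on `L²(ℝ²)` in the sense of tempered distributions (everywhere defined if
`V` is bounded). -/
def deltaVDist (V : Plane → ℝ) : L2 →ₗ.[ℂ] 𝓢'(Plane, ℂ) :=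
  everywhere (lapDist ∘ₗ toDist) - toDist.compPMap (mulOp (fun x => (V x : ℂ)))

/-- The function `M(t) = exp (-i |x|² / (2 t))`. -/
def phase (t : ℝ) (x : Plane) : ℂ :=
  Complex.exp (-(Complex.I / (2 * (t : ℂ))) * ((‖x‖ ^ 2 : ℝ) : ℂ))

/-- Multiplication by `M(t)` in `L²(ℝ²)`. -/
def phaseOp (t : ℝ) : L2 →ₗ.[ℂ] L2 := mulOp (phase t)

/-- Multiplication by `M(t)` on tempered distributions. -/
def phaseDist (t : ℝ) : 𝓢'(Plane, ℂ) →ₗ[ℂ] 𝓢'(Plane, ℂ) :=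
  (TemperedDistribution.smulLeftCLM ℂ (phase t) : 𝓢'(Plane, ℂ) →L[ℂ] 𝓢'(Plane, ℂ))

/-- `(-Δ_V)^(s/2)` in `L²(ℝ²)`. -/
def powV (V : Plane → ℝ) (s : ℝ) : L2 →ₗ.[ℂ] L2 := opPow (-deltaV V) (s / 2)

/-- `(-t² Δ_V)^(s/2)` in `L²(ℝ²)`. -/
def scaledPowV (V : Plane → ℝ) (s t : ℝ) : L2 →ₗ.[ℂ] L2 :=
  opPow (((t ^ 2 : ℝ) : ℂ) • (-deltaV V)) (s / 2)

/-- `(1 - Δ_V)⁻¹` on `L²(ℝ²)`. -/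
def resV (V : Plane → ℝ) : L2 →ₗ.[ℂ] L2 :=
  everywhere (resolventOne (-deltaV V) : L2 →ₗ[ℂ] L2)

/-- The extension, with values in the tempered distributions, of an operator `B` in `L²(ℝ²)` that is
a function of `-Δ_V`: `f ↦ (1 - Δ_V) B (1 - Δ_V)⁻¹ f`, where the outer factor `1 - Δ_V` acts on `L²`
in the sense of distributions, and the domain is `{f ∈ L² : (1 - Δ_V)⁻¹ f ∈ D(B)}`. Since `B`
commutes with `(1 - Δ_V)⁻¹`, this domain contains `D(B)`, and the extension agrees with `B` there. For
`B = (-Δ_V)^(s/2)` with `0 < s ≤ 2` the extension is defined on all of `L²`. -/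
def extendV (V : Plane → ℝ) (B : L2 →ₗ.[ℂ] L2) : L2 →ₗ.[ℂ] 𝓢'(Plane, ℂ) :=
  pComp (everywhere toDist - deltaVDist V) (pComp B (resV V))

/-- `|J_V|^s(t) = M(-t) (-t² Δ_V)^(s/2) M(t)` in `L²(ℝ²)`. -/
def JV (V : Plane → ℝ) (s t : ℝ) : L2 →ₗ.[ℂ] L2 :=
  pComp (phaseOp (-t)) (pComp (scaledPowV V s t) (phaseOp t))

/-- `|J_V|^s(t) = M(-t) (-t² Δ_V)^(s/2) M(t)` with the middle factor extended as in `extendV`, so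
that its values may be distributions. -/
def JVDist (V : Plane → ℝ) (s t : ℝ) : L2 →ₗ.[ℂ] 𝓢'(Plane, ℂ) :=
  (phaseDist (-t)).compPMap (pComp (extendV V (scaledPowV V s t)) (phaseOp t))

/-- `x · ∇` in `L²(ℝ²)` with domain `{f ∈ L² : x · ∇ f ∈ L²}`. -/
def euler : L2 →ₗ.[ℂ] L2 := l2Part eulerDist

/-- `A(s) = s (-Δ_V)^(s/2) + [x · ∇, (-Δ_V)^(s/2)]`, with values in the tempered distributions. In
`(x · ∇) (-Δ_V)^(s/2)` the operator `x · ∇` acts in the sense of distributions; in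
`(-Δ_V)^(s/2) (x · ∇)` the power is extended as in `extendV`. -/
def opA (V : Plane → ℝ) (s : ℝ) : L2 →ₗ.[ℂ] 𝓢'(Plane, ℂ) :=
  (s : ℂ) • toDist.compPMap (powV V s) +
    ((eulerDist ∘ₗ toDist).compPMap (powV V s) - pComp (extendV V (powV V s)) euler)

/-- `M(-t) A(s) M(t)`. -/
def MAM (V : Plane → ℝ) (s t : ℝ) : L2 →ₗ.[ℂ] 𝓢'(Plane, ℂ) :=
  (phaseDist (-t)).compPMap (pComp (opA V s) (phaseOp t))

/-! ### Functions of time -/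

/-- `f(t) ∈ D(B(t))` for almost every `t ∈ I`, and `t ↦ B(t) f(t)` is in `L¹_loc(I; L²(ℝ²))`. -/
def LocIntDomain (I : Set ℝ) (B : ℝ → L2 →ₗ.[ℂ] L2) (f : ℝ → L2) : Prop :=
  (∀ᵐ t ∂(volume.restrict I), f t ∈ (B t).domain) ∧
    LocallyIntegrableOn (fun t => pApply (B t) (f t)) I volume

/-- `θ` is a test function on the open set `I` of times. -/
def IsTimeTest (I : Set ℝ) (θ : ℝ → ℂ) : Prop :=
  ContDiff ℝ ∞ θ ∧ HasCompactSupport θ ∧ tsupport θ ⊆ I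

/-- The distribution on `I`, with values in the tempered distributions on `ℝ²`, that is given by the
function `t ↦ T t`, evaluated at `θ ⊗ φ`. -/
def timeDist (I : Set ℝ) (T : ℝ → 𝓢'(Plane, ℂ)) (θ : ℝ → ℂ) (φ : 𝓢(Plane, ℂ)) : ℂ :=
  ∫ t in I, θ t * T t φ

/-- The function `t ↦ T t` is locally integrable on `I` when tested with Schwartz functions, so that
it does define a distribution. -/
def IsLocInt (I : Set ℝ) (T : ℝ → 𝓢'(Plane, ℂ)) : Prop :=
  ∀ φ : 𝓢(Plane, ℂ), LocallyIntegrableOn (fun t => T t φ) I volume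

/-- The distribution `(i ∂_t + ½ Δ_V) w` for `w ∈ L¹_loc(I; L²(ℝ²))`, evaluated at `θ ⊗ φ`. -/
def schrodinger (V : Plane → ℝ) (I : Set ℝ) (w : ℝ → L2) (θ : ℝ → ℂ) (φ : 𝓢(Plane, ℂ)) : ℂ :=
  Complex.I * timeDist I (fun t => toDist (w t)) (fun t => -deriv θ t) φ +
    (1 / 2) * timeDist I (fun t => pApply (deltaVDist V) (w t)) θ φ

end

noncomputable section

/-! ### Nonnegative self-adjoint operators through their resolvent -/

section AbstractPowers

variable {H : Type*} [NormedAddCommGroup H] [InnerProductSpace ℂ H] [CompleteSpace H]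

/-! Put `v = M(t) u`, `B = (-Δ_V)^(s/2)`, `b = B v`. Conjugation with the phase turns `i ∂ₜ + ½ Δ_V`
into `i ∂ₜ + ½ Δ_V + (i/t)(x · ∇ + 1)`: the `|x|²` terms produced by `∂ₜ` and by `Δ` cancel, and `1`
is half the dimension. As `B` commutes with `∂ₜ` and `Δ_V`, the equation for `v` gives `(i ∂ₜ + ½
Δ_V) b + (i/t)(B (x · ∇ v) + b) = B M(t) F`. Since `|J_V|^s u = t^s M(-t) b`, conjugating back
contributes `(i/t)(x · ∇ + 1) b` and the factor `t^s` contributes `(i s/t) b`. The two terms `(i/t)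
b` without `s` cancel, and what is left is `(i/t) A(s) v`.

To make this rigorous, every equation is first multiplied by `R = (1 - Δ_V)⁻¹`, so that `Δ_V` enters
only through `Δ_V R = R - 1`, and `R u`, `R v`, `R b` have weak time derivatives in `L¹_loc(I; L²)`
(`isWeakDeriv_res`, `isWeakDeriv_res_gaussOp`, `isWeakDeriv_res_pow`). The test vectors are `h_φ =
conj ((1 - Δ + V) φ)` (`helmVec`): they are total, and `R h_φ = conj φ`. A time-dependent phase is
moved onto the test vector. The resulting curve is smooth in `L²`, and a weak derivative may be
tested with such a curve (`IsWeakDeriv.integral_inner_eq_zero`).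

The unbounded `B` is never applied to an equation. With `a = s/2` its graph is `{(R^a f, (1 - R)^a
f)}`, so `R^a B f = (1 - R)^a f`. One applies the bounded operator `(1 - R)^a`, recognizes a common
factor `R^a`, and cancels it by injectivity. This needs only `0 ≤ R ≤ 1`, which comes from the
Fourier transform for `-Δ` and from a positive perturbation for `-Δ + V`. `commutator_identity` then
carries out the conjugation back. -/

/-- `R` is the bounded inverse of `1 + T`, and `0 ≤ R ≤ 1`. -/
structure IsResolvent (T : H →ₗ.[ℂ] H) (R : H →L[ℂ] H) : Prop where
  apply_eq_iff : ∀ f g : H, R f = g ↔ (g, f - g) ∈ T.graph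
  nonneg : 0 ≤ R
  le_one : R ≤ 1

namespace IsResolvent

variable {T : H →ₗ.[ℂ] H} {R : H →L[ℂ] H}

theorem resolventOne_eq (h : IsResolvent T R) : resolventOne T = R := by
  have hex : ∃ R : H →L[ℂ] H, ∀ f g : H, R f = g ↔ (g, f - g) ∈ T.graph := ⟨R, h.apply_eq_iff⟩
  rw [resolventOne, dif_pos hex]
  ext f
  exact (hex.choose_spec f _).2 ((h.apply_eq_iff f _).1 rfl)

theorem isSelfAdjoint (h : IsResolvent T R) : IsSelfAdjoint R := IsSelfAdjoint.of_nonneg h.nonneg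

theorem injective (h : IsResolvent T R) : Function.Injective R := by
  rw [injective_iff_map_eq_zero]
  intro f hf
  have := (h.apply_eq_iff f 0).1 hf
  rw [sub_zero] at this
  exact T.graph_fst_eq_zero_snd this rfl

theorem spectrum_subset (h : IsResolvent T R) : spectrum ℝ R ⊆ Icc 0 1 := by
  intro x hx
  refine ⟨spectrum_nonneg_of_nonneg h.nonneg hx, ?_⟩
  have := h.le_one
  rw [← map_one (algebraMap ℝ (H →L[ℂ] H)),
    le_algebraMap_iff_spectrum_le h.isSelfAdjoint] at this
  exact this x hx

end IsResolvent

/-! ### Powers by functional calculus of the resolvent -/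

theorem continuous_one_sub_rpow {a : ℝ} (ha : 0 ≤ a) : Continuous fun x : ℝ => (1 - x) ^ a :=
  (Real.continuous_rpow_const ha).comp (continuous_const.sub continuous_id)

/-- `R ^ a` as a function of the self-adjoint operator `R`. -/
abbrev cfcPow (R : H →L[ℂ] H) (a : ℝ) : H →L[ℂ] H := cfc (fun x : ℝ => x ^ a) R

/-- `(1 - R) ^ a` as a function of the self-adjoint operator `R`. -/
abbrev cfcCompl (R : H →L[ℂ] H) (a : ℝ) : H →L[ℂ] H := cfc (fun x : ℝ => (1 - x) ^ a) R

namespace IsResolvent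

variable {T : H →ₗ.[ℂ] H} {R : H →L[ℂ] H}

/-- For a natural number `n ≥ a` one has `R ^ n = R ^ (n - a) R ^ a`, and `R ^ n` is injective
because `R` is. -/
theorem injective_cfcPow (h : IsResolvent T R) {a : ℝ} (ha : 0 < a) :
    Function.Injective (cfcPow R a) := by
  obtain ⟨n, hn⟩ := exists_nat_ge a
  have hR := h.isSelfAdjoint
  have key : R ^ n = cfcPow R (n - a) * cfcPow R a := by
    rw [← cfc_mul (fun x : ℝ => x ^ ((n : ℝ) - a)) (fun x : ℝ => x ^ a) R
      (Real.continuous_rpow_const (sub_nonneg.2 hn)).continuousOn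
      (Real.continuous_rpow_const ha.le).continuousOn]
    conv_lhs => rw [← cfc_id ℝ R, ← cfc_pow (fun x : ℝ => id x) n R]
    refine cfc_congr fun x hx => ?_
    have hx0 := (h.spectrum_subset hx).1
    -- The spectrum may contain `0`, so the exponent law is used in the form valid for `x ≥ 0` when
    -- the total exponent is nonzero.
    have hn0 : (n : ℝ) ≠ 0 := by linarith
    change x ^ n = _
    rw [← Real.rpow_add' hx0 (by simpa using hn0), sub_add_cancel, Real.rpow_natCast]
  rw [injective_iff_map_eq_zero]
  intro f hf
  have h0 : (R ^ n) f = 0 := by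
    rw [key]
    change cfcPow R (n - a) (cfcPow R a f) = 0
    rw [hf, map_zero]
  have hinj : Function.Injective (R ^ n) := by
    rw [show ⇑(R ^ n) = R^[n] from FunLike.coe_pow_eq_iterate R n]
    exact h.injective.iterate n
  exact (injective_iff_map_eq_zero _).1 hinj f h0

/-- The range in the definition is really a graph: `R ^ a` is injective, so the first component
determines `f` and with it the second. -/
theorem graph_opPow (h : IsResolvent T R) {a : ℝ} (ha : 0 < a) {g k : H} :
    (g, k) ∈ (opPow T a).graph ↔ ∃ f, cfcPow R a f = g ∧ cfcCompl R a f = k := by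
  unfold opPow
  rw [h.resolventOne_eq, Submodule.toLinearPMap_graph_eq]
  · simp [LinearMap.mem_range, Prod.ext_iff]
  · rintro ⟨g, k⟩ hx hg
    obtain ⟨f, hf⟩ := hx
    have h1 : cfcPow R a f = g := congrArg Prod.fst hf
    have h2 : cfcCompl R a f = k := congrArg Prod.snd hf
    change g = 0 at hg
    change k = 0
    rw [← h2, (injective_iff_map_eq_zero _).1 (h.injective_cfcPow ha) f (h1.trans hg), map_zero]

/-- `R ^ a T ^ a f = (1 - R) ^ a f` on the domain of `T ^ a`. -/
theorem cfcPow_of_mem_graph (h : IsResolvent T R) {a : ℝ} (ha : 0 < a) {g k : H}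
    (hg : (g, k) ∈ (opPow T a).graph) : cfcPow R a k = cfcCompl R a g := by
  obtain ⟨f, rfl, rfl⟩ := (h.graph_opPow ha).1 hg
  have := cfc_commute_cfc (fun x : ℝ => x ^ a) (fun x : ℝ => (1 - x) ^ a) R
  exact congrArg (fun A : H →L[ℂ] H => A f) this.eq

theorem cfc_apply_comm (h : IsResolvent T R) (f : ℝ → ℝ) (x : H) :
    cfc f R (R x) = R (cfc f R x) := by
  have := cfc_commute_cfc f id R
  rw [cfc_id ℝ R h.isSelfAdjoint] at this
  exact congrArg (fun A : H →L[ℂ] H => A x) this.eq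

/-- The resolvent of `c T`, `c > 0`, as a function of the resolvent of `T`. -/
theorem smul (h : IsResolvent T R) {c : ℝ} (hc : 0 < c) :
    IsResolvent ((c : ℂ) • T) (cfc (fun x : ℝ => x / (x + c * (1 - x))) R) := by
  -- If `x = (1 + λ)⁻¹`, then `(1 + c λ)⁻¹ = x / (x + c (1 - x))`. The denominator is positive on
  -- all of `[0, 1]`, also at `x = 0`, since `c > 0`.
  have hpos : ∀ x ∈ spectrum ℝ R, 0 < x + c * (1 - x) := by
    intro x hx
    obtain ⟨h0, h1⟩ := h.spectrum_subset hx
    rcases h0.eq_or_lt with rfl | h0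
    · simpa using hc
    · have := mul_nonneg hc.le (sub_nonneg.2 h1)
      linarith
  have hcont : ContinuousOn (fun x : ℝ => (x + c * (1 - x))⁻¹) (spectrum ℝ R) :=
    ContinuousOn.inv₀ (by fun_prop) fun x hx => (hpos x hx).ne'
  have hRsa := h.isSelfAdjoint
  set q := cfc (fun x : ℝ => (x + c * (1 - x))⁻¹) R with hq
  have hD : cfc (fun x : ℝ => x + c * (1 - x)) R = R + (c : ℂ) • (1 - R) := by
    rw [cfc_add (a := R) (fun x : ℝ => x) (fun x : ℝ => c * (1 - x)), cfc_id' ℝ R,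
      cfc_const_mul c (fun x : ℝ => 1 - x) R, cfc_sub (a := R) (fun _ : ℝ => 1) (fun x : ℝ => x),
      cfc_const_one ℝ R, cfc_id' ℝ R]
    rfl
  have hqD : q * (R + (c : ℂ) • (1 - R)) = 1 := by
    rw [← hD, hq, ← cfc_mul _ _ R hcont, ← cfc_const_one ℝ R]
    exact cfc_congr fun x hx => inv_mul_cancel₀ (hpos x hx).ne'
  have hDq : (R + (c : ℂ) • (1 - R)) * q = 1 := by
    rw [← hD, hq, ← cfc_mul _ _ R (by fun_prop) hcont, ← cfc_const_one ℝ R]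
    exact cfc_congr fun x hx => mul_inv_cancel₀ (hpos x hx).ne'
  have hRq : cfc (fun x : ℝ => x / (x + c * (1 - x))) R = q * R := by
    conv_rhs => rw [← cfc_id' ℝ R, hq, ← cfc_mul _ _ R hcont]
    exact cfc_congr fun x _ => by
      rw [div_eq_mul_inv, mul_comm]
  have hc' : (c : ℂ) ≠ 0 := by exact_mod_cast hc.ne'
  refine ⟨fun f g => ?_, ?_, ?_⟩
  · have h1 : (g, f - g) ∈ ((c : ℂ) • T).graph ↔ (g, (c : ℂ)⁻¹ • (f - g)) ∈ T.graph := by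
      rw [LinearPMap.smul_graph, Submodule.mem_map]
      constructor
      · rintro ⟨⟨x, y⟩, hxy, he⟩
        have e1 : x = g := congrArg Prod.fst he
        have e2 : (c : ℂ) • y = f - g := congrArg Prod.snd he
        rw [← e2, inv_smul_smul₀ hc', ← e1]
        exact hxy
      · intro hx
        refine ⟨_, hx, Prod.ext rfl ?_⟩
        exact smul_inv_smul₀ hc' (f - g)
    -- With `D = R + c (1 - R)`, the condition `g = R (g + c⁻¹ (f - g))` multiplied by `c` reads `R
    -- f = D g`. Hence the new resolvent is `D⁻¹ R`.
    have h2 : (g, (c : ℂ)⁻¹ • (f - g)) ∈ T.graph ↔ R f = (R + (c : ℂ) • (1 - R)) g := by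
      have := h.apply_eq_iff (g + (c : ℂ)⁻¹ • (f - g)) g
      rw [add_sub_cancel_left] at this
      rw [← this, map_add, map_smul, map_sub]
      change _ ↔ R f = R g + (c : ℂ) • (g - R g)
      constructor
      · intro hg
        have := congrArg (fun z => (c : ℂ) • z) hg
        simp only [smul_add, smul_inv_smul₀ hc'] at this
        rw [smul_sub, ← this]
        abel
      · intro hg
        rw [hg, add_sub_cancel_left, inv_smul_smul₀ hc']
        abel
    rw [h1, h2, hRq]
    constructor
    · rintro rfl
      exact (congrArg (fun A : H →L[ℂ] H => A (R f)) hDq).symm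
    · intro hf
      change q (R f) = g
      rw [hf]
      exact congrArg (fun A : H →L[ℂ] H => A g) hqD
  · exact cfc_nonneg fun x hx => div_nonneg (h.spectrum_subset hx).1 (hpos x hx).le
  · refine cfc_le_one _ _ fun x hx => ?_
    rw [div_le_one (hpos x hx)]
    have := mul_nonneg hc.le (sub_nonneg.2 (h.spectrum_subset hx).2)
    linarith

/-- Homogeneity of the power: `(c T) ^ a = c ^ a T ^ a` for `c > 0`. -/
theorem opPow_smul (h : IsResolvent T R) {c a : ℝ} (hc : 0 < c) (ha : 0 < a) :
    opPow ((c : ℂ) • T) a = ((c ^ a : ℝ) : ℂ) • opPow T a := by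
  have hpos : ∀ x ∈ spectrum ℝ R, 0 < x + c * (1 - x) := by
    intro x hx
    obtain ⟨h0, h1⟩ := h.spectrum_subset hx
    rcases h0.eq_or_lt with rfl | h0
    · simpa using hc
    · have := mul_nonneg hc.le (sub_nonneg.2 h1)
      linarith
  have hRsa := h.isSelfAdjoint
  have hca : ((c ^ a : ℝ) : ℂ) ≠ 0 := by exact_mod_cast (Real.rpow_pos_of_pos hc a).ne'
  have hcont : ContinuousOn (fun x : ℝ => (x + c * (1 - x))⁻¹ ^ a) (spectrum ℝ R) :=
    (Real.continuous_rpow_const ha.le).comp_continuousOn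
      (ContinuousOn.inv₀ (by fun_prop) fun x hx => (hpos x hx).ne')
  have hcont' : ContinuousOn (fun x : ℝ => (x + c * (1 - x)) ^ a) (spectrum ℝ R) :=
    (Real.continuous_rpow_const ha.le).comp_continuousOn (by fun_prop)
  have hcontq : ContinuousOn (fun x : ℝ => x / (x + c * (1 - x))) (spectrum ℝ R) :=
    ContinuousOn.div (by fun_prop) (by fun_prop) fun x hx => (hpos x hx).ne'
  -- Up to the scalar `c ^ a`, both powers of the new resolvent are those of `R` times the
  -- invertible operator `q`. The two graphs therefore agree after the change of parameter from `f`
  -- to `q f`.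
  set q := cfc (fun x : ℝ => (x + c * (1 - x))⁻¹ ^ a) R with hq
  set d := cfc (fun x : ℝ => (x + c * (1 - x)) ^ a) R with hd
  have hqd : q * d = 1 := by
    rw [hq, hd, ← cfc_mul _ _ R hcont hcont', ← cfc_const_one ℝ R]
    refine cfc_congr fun x hx => ?_
    rw [← Real.mul_rpow (inv_nonneg.2 (hpos x hx).le) (hpos x hx).le,
      inv_mul_cancel₀ (hpos x hx).ne', Real.one_rpow]
  have e1 : cfcPow (cfc (fun x : ℝ => x / (x + c * (1 - x))) R) a = cfcPow R a * q := by
    rw [cfcPow, ← cfc_comp _ _ R hRsa (Real.continuous_rpow_const ha.le).continuousOn hcontq, hq,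
      ← cfc_mul _ _ R (Real.continuous_rpow_const ha.le).continuousOn hcont]
    refine cfc_congr fun x hx => ?_
    simp only [Function.comp]
    rw [← Real.mul_rpow (h.spectrum_subset hx).1 (inv_nonneg.2 (hpos x hx).le), div_eq_mul_inv]
  have e2 : cfcCompl (cfc (fun x : ℝ => x / (x + c * (1 - x))) R) a =
      ((c ^ a : ℝ) : ℂ) • (cfcCompl R a * q) := by
    have : ((c ^ a : ℝ) : ℂ) • (cfcCompl R a * q) = (c ^ a) • (cfcCompl R a * q) := rfl
    rw [this, cfcCompl, ← cfc_comp _ _ R hRsa (continuous_one_sub_rpow ha.le).continuousOn hcontq,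
      hq, ← cfc_mul _ _ R (continuous_one_sub_rpow ha.le).continuousOn hcont,
      ← cfc_smul (c ^ a) (fun x : ℝ => (1 - x) ^ a * (x + c * (1 - x))⁻¹ ^ a) R
        ((continuous_one_sub_rpow ha.le).continuousOn.mul hcont)]
    refine cfc_congr fun x hx => ?_
    simp only [Function.comp, smul_eq_mul]
    have h1 := sub_nonneg.2 (h.spectrum_subset hx).2
    rw [← Real.mul_rpow h1 (inv_nonneg.2 (hpos x hx).le), ← Real.mul_rpow hc.le
      (mul_nonneg h1 (inv_nonneg.2 (hpos x hx).le))]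
    congr 1
    have := (hpos x hx).ne'
    field_simp
    ring
  apply LinearPMap.eq_of_eq_graph
  ext ⟨g, k⟩
  rw [(h.smul hc).graph_opPow ha, LinearPMap.smul_graph, Submodule.mem_map, e1, e2]
  constructor
  · rintro ⟨f, rfl, rfl⟩
    exact ⟨(cfcPow R a (q f), cfcCompl R a (q f)), (h.graph_opPow ha).2 ⟨_, rfl, rfl⟩, rfl⟩
  · rintro ⟨⟨x, y⟩, hxy, he⟩
    obtain ⟨f, h1, h2⟩ := (h.graph_opPow ha).1 hxy
    have e3 : x = g := congrArg Prod.fst he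
    have e4 : ((c ^ a : ℝ) : ℂ) • y = k := congrArg Prod.snd he
    have hqdf : q (d f) = f := congrArg (fun A : H →L[ℂ] H => A f) hqd
    refine ⟨d f, ?_, ?_⟩
    · change cfcPow R a (q (d f)) = g
      rw [hqdf, h1, e3]
    · change ((c ^ a : ℝ) : ℂ) • cfcCompl R a (q (d f)) = k
      rw [hqdf, h2, e4]

/-- Bounded nonnegative perturbations. -/
theorem exists_of_add {T₀ : H →ₗ.[ℂ] H} {R₀ V : H →L[ℂ] H} (h : IsResolvent T₀ R₀) (hV : 0 ≤ V)
    (hT : ∀ g k : H, (g, k) ∈ T.graph ↔ (g, k - V g) ∈ T₀.graph) : ∃ R, IsResolvent T R := by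
  -- Symmetric resolvent formula: `R = S (1 + S V S)⁻¹ S` with `S = R₀^(1/2)`. In this form `0 ≤ R ≤
  -- R₀ ≤ 1` is immediate.
  set S := CFC.sqrt R₀ with hS
  have hS0 : 0 ≤ S := CFC.sqrt_nonneg R₀
  have hSS : S * S = R₀ := CFC.sqrt_mul_sqrt_self R₀ h.nonneg
  set K := S * V * S with hK
  have hK0 : 0 ≤ K := conjugate_nonneg_of_nonneg hV hS0
  have hKsa : IsSelfAdjoint K := IsSelfAdjoint.of_nonneg hK0
  have hpos : ∀ x ∈ spectrum ℝ K, 0 < 1 + x := fun x hx => by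
    have := spectrum_nonneg_of_nonneg hK0 hx
    linarith
  have hcont : ContinuousOn (fun x : ℝ => (1 + x)⁻¹) (spectrum ℝ K) :=
    ContinuousOn.inv₀ (by fun_prop) fun x hx => (hpos x hx).ne'
  set N := cfc (fun x : ℝ => (1 + x)⁻¹) K with hN
  have hN0 : 0 ≤ N := cfc_nonneg fun x hx => inv_nonneg.2 (hpos x hx).le
  have hN1 : N ≤ 1 := cfc_le_one _ _ fun x hx => by
    have := spectrum_nonneg_of_nonneg hK0 hx
    exact inv_le_one_of_one_le₀ (by linarith)
  have hKN : (1 + K) * N = 1 := by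
    have h1 : cfc (fun x : ℝ => 1 + x) K = 1 + K := by
      rw [cfc_add (a := K) (fun _ : ℝ => 1) (fun x : ℝ => x), cfc_const_one ℝ K, cfc_id' ℝ K]
    rw [← h1, hN, ← cfc_mul _ _ K (by fun_prop) hcont, ← cfc_const_one ℝ K]
    exact cfc_congr fun x hx => mul_inv_cancel₀ (hpos x hx).ne'
  have hiff : ∀ f g : H, (g, f - g) ∈ T.graph ↔ R₀ (f - V g) = g := by
    intro f g
    rw [hT, h.apply_eq_iff, sub_right_comm]
  have hsol : ∀ f : H, R₀ (f - V ((S * N * S) f)) = (S * N * S) f := by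
    intro f
    have h1 : N (S f) + S (V (S (N (S f)))) = S f :=
      congrArg (fun A : H →L[ℂ] H => A (S f)) hKN
    have h2 : ∀ z, S (S z) = R₀ z := fun z => congrArg (fun A : H →L[ℂ] H => A z) hSS
    have h3 := congrArg S h1
    rw [map_add, h2, h2] at h3
    rw [map_sub, ← h3]
    change _ - R₀ (V (S (N (S f)))) = S (N (S f))
    abel
  -- The difference `e` of two solutions satisfies `R₀ V e = -e`, so `‖S V e‖² = ⟨R₀ V e, V e⟩ =
  -- -⟨e, V e⟩`, whose real part is `≤ 0`. Thus `S V e = 0`, and `e = -S (S V e) = 0`.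
  have huniq : ∀ f g g' : H, R₀ (f - V g) = g → R₀ (f - V g') = g' → g = g' := by
    intro f g g' h1 h2
    set e := g - g' with he
    have h3 : e = -R₀ (V e) := by
      rw [map_sub] at h1 h2
      calc e = (R₀ f - R₀ (V g)) - (R₀ f - R₀ (V g')) := by rw [h1, h2]
        _ = -R₀ (V e) := by
          rw [he, map_sub, map_sub]
          abel
    have hRp := (ContinuousLinearMap.nonneg_iff_isPositive _).1 h.nonneg
    have hVp := (ContinuousLinearMap.nonneg_iff_isPositive _).1 hV
    have h4 := hVp.re_inner_nonneg_right e
    have h5 := hRp.re_inner_nonneg_left (V e)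
    rw [eq_neg_iff_add_eq_zero, add_comm, ← eq_neg_iff_add_eq_zero] at h3
    have h6 : S (V e) = 0 := by
      have h7 : inner ℂ (S (V e)) (S (V e)) = inner ℂ (R₀ (V e)) (V e) := by
        rw [← hSS]
        exact (((ContinuousLinearMap.nonneg_iff_isPositive _).1 hS0).inner_left_eq_inner_right
          (S (V e)) (V e)).symm
      rw [h3, inner_neg_left, map_neg] at h5
      rw [h3] at h7
      have h8 := congrArg Complex.re h7
      rw [inner_neg_left] at h8
      have h9 : RCLike.re (inner ℂ (S (V e)) (S (V e))) ≤ 0 := by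
        change (inner ℂ (S (V e)) (S (V e))).re ≤ 0
        rw [h8]
        change 0 ≤ (inner ℂ e (V e)).re at h4
        rw [Complex.neg_re]
        linarith
      rw [inner_self_eq_norm_sq] at h9
      have : ‖S (V e)‖ ^ 2 = 0 := le_antisymm h9 (sq_nonneg _)
      exact norm_eq_zero.1 (pow_eq_zero_iff two_ne_zero |>.1 this)
    have h10 : R₀ (V e) = 0 := by
      rw [← hSS]
      change S (S (V e)) = 0
      rw [h6, map_zero]
    rw [h10, eq_comm, neg_eq_zero] at h3
    exact sub_eq_zero.1 h3
  refine ⟨S * N * S, fun f g => ?_, conjugate_nonneg_of_nonneg hN0 hS0, ?_⟩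
  · rw [hiff]
    constructor
    · rintro rfl
      exact hsol f
    · exact fun hg => huniq f _ _ (hsol f) hg
  · calc S * N * S ≤ S * 1 * S := conjugate_le_conjugate_of_nonneg hN1 hS0
      _ = R₀ := by rw [mul_one, hSS]
      _ ≤ 1 := h.le_one

end IsResolvent

end AbstractPowers

/-! ### Weak derivatives in time of functions with values in a Hilbert space -/

namespace IsTimeTest

variable {I : Set ℝ} {θ : ℝ → ℂ}

theorem deriv (h : IsTimeTest I θ) : IsTimeTest I (deriv θ) := by
  refine ⟨?_, h.2.1.deriv, fun t ht => h.2.2 (tsupport_deriv_subset ht)⟩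
  exact (contDiff_infty_iff_deriv.1 h.1).2

/-- Smoothness of `g` on `I` suffices, because the product vanishes near every point outside the
support of `θ`. This admits weights such as `t ^ s`. -/
theorem mul_contDiffOn (h : IsTimeTest I θ) (hI : IsOpen I) {g : ℝ → ℂ} (hg : ContDiffOn ℝ ∞ g I) :
    IsTimeTest I (fun t => θ t * g t) := by
  have hsub : tsupport (fun t => θ t * g t) ⊆ tsupport θ :=
    closure_mono fun t ht => left_ne_zero_of_mul ht
  refine ⟨?_, h.2.1.mul_right, hsub.trans h.2.2⟩
  rw [contDiff_iff_contDiffAt]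
  intro t
  by_cases ht : t ∈ tsupport θ
  · exact h.1.contDiffAt.mul (hg.contDiffAt (hI.mem_nhds (h.2.2 ht)))
  · refine (contDiffAt_const (c := (0 : ℂ))).congr_of_eventuallyEq ?_
    filter_upwards [(isClosed_tsupport θ).isOpen_compl.mem_nhds ht] with r hr
    rw [image_eq_zero_of_notMem_tsupport hr, zero_mul]

theorem integrableOn_smul {E : Type*} [NormedAddCommGroup E] [NormedSpace ℂ E] {y : ℝ → E}
    (h : IsTimeTest I θ) (hy : LocallyIntegrableOn y I volume) :
    IntegrableOn (fun t => θ t • y t) I volume := by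
  have h1 : IntegrableOn (fun t => θ t • y t) (tsupport θ) volume :=
    (hy.integrableOn_compact_subset h.2.2 h.2.1).continuousOn_smul h.1.continuous.continuousOn
      h.2.1
  have h2 : IntegrableOn (fun t => θ t • y t) univ volume :=
    h1.of_forall_sdiff_eq_zero MeasurableSet.univ fun t ht => by
      rw [image_eq_zero_of_notMem_tsupport ht.2, zero_smul]
  exact h2.mono_set (subset_univ _)

theorem integrableOn_mul {y : ℝ → ℂ} (h : IsTimeTest I θ) (hy : LocallyIntegrableOn y I volume) :
    IntegrableOn (fun t => θ t * y t) I volume :=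
  h.integrableOn_smul hy

end IsTimeTest

section WeakDeriv

variable {H : Type*} [NormedAddCommGroup H] [InnerProductSpace ℂ H]

theorem MeasureTheory.LocallyIntegrableOn.inner_continuousOn {I : Set ℝ} (hI : IsOpen I)
    {ζ y : ℝ → H} (hζ : ContinuousOn ζ I) (hy : LocallyIntegrableOn y I volume) :
    LocallyIntegrableOn (fun t => inner ℂ (ζ t) (y t)) I volume := by
  rw [locallyIntegrableOn_iff hI.isLocallyClosed]
  intro k hkI hk
  obtain ⟨C, hC⟩ := hk.exists_bound_of_continuousOn (hζ.mono hkI)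
  have hyk := hy.integrableOn_compact_subset hkI hk
  refine (hyk.norm.const_mul C).mono' (AEStronglyMeasurable.inner
    ((hζ.mono hkI).aestronglyMeasurable hk.measurableSet) hyk.aestronglyMeasurable) ?_
  filter_upwards [ae_restrict_mem hk.measurableSet] with t ht
  exact (norm_inner_le_norm _ _).trans (mul_le_mul_of_nonneg_right (hC t ht) (norm_nonneg _))

/-- `K` is the derivative of `y` on `I` in the sense of distributions with values in `H`. -/
def IsWeakDeriv (I : Set ℝ) (y K : ℝ → H) : Prop :=
  ∀ θ, IsTimeTest I θ → ∫ t in I, deriv θ t • y t = -∫ t in I, θ t • K t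

/-- Distinct orthonormal vectors are `√2 > 1` apart, so balls of radius `1/2` around them are
disjoint. -/
theorem HilbertBasis.countable [TopologicalSpace.SeparableSpace H] {ι : Type*}
    (b : HilbertBasis ι ℂ H) : Countable ι := by
  refine Pairwise.countable_of_isOpen_disjoint (s := fun i => Metric.ball (b i) (1 / 2)) ?_
    (fun i => Metric.isOpen_ball) (fun i => ⟨b i, Metric.mem_ball_self (by norm_num)⟩)
  intro i j hij
  refine Metric.ball_disjoint_ball ?_
  have h1 : ‖b i - b j‖ ^ 2 = 2 := by
    rw [@norm_sub_sq ℂ, b.orthonormal.1 i, b.orthonormal.1 j, b.orthonormal.2 hij]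
    norm_num
  rw [dist_eq_norm]
  nlinarith [norm_nonneg (b i - b j)]

/-- Cauchy–Schwarz and Bessel. The bound does not depend on `s`, which makes it a majorant for
dominated convergence. -/
theorem HilbertBasis.norm_sum_inner_mul_inner_le {ι : Type*} (b : HilbertBasis ι ℂ H)
    (s : Finset ι) (x y : H) :
    ‖∑ i ∈ s, inner ℂ x (b i) * inner ℂ (b i) y‖ ≤ ‖x‖ * ‖y‖ := by
  have hx : ∑ i ∈ s, ‖inner ℂ x (b i)‖ ^ 2 ≤ ‖x‖ ^ 2 := by
    refine le_of_eq_of_le (Finset.sum_congr rfl fun i _ => ?_)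
      (b.orthonormal.sum_inner_products_le x (s := s))
    rw [norm_inner_symm]
  have hy : ∑ i ∈ s, ‖inner ℂ (b i) y‖ ^ 2 ≤ ‖y‖ ^ 2 := b.orthonormal.sum_inner_products_le y
  calc ‖∑ i ∈ s, inner ℂ x (b i) * inner ℂ (b i) y‖
      ≤ ∑ i ∈ s, ‖inner ℂ x (b i)‖ * ‖inner ℂ (b i) y‖ := by
        refine (norm_sum_le _ _).trans (le_of_eq ?_)
        simp only [norm_mul]
    _ ≤ √(∑ i ∈ s, ‖inner ℂ x (b i)‖ ^ 2) * √(∑ i ∈ s, ‖inner ℂ (b i) y‖ ^ 2) :=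
        Real.sum_mul_le_sqrt_mul_sqrt _ _ _
    _ ≤ ‖x‖ * ‖y‖ := by
        gcongr
        · exact Real.sqrt_le_iff.2 ⟨norm_nonneg _, hx⟩
        · exact Real.sqrt_le_iff.2 ⟨norm_nonneg _, hy⟩

variable [CompleteSpace H]

theorem IsWeakDeriv.map {I : Set ℝ} {y K : ℝ → H} (h : IsWeakDeriv I y K)
    (hy : LocallyIntegrableOn y I volume) (hK : LocallyIntegrableOn K I volume) (C : H →L[ℂ] H) :
    IsWeakDeriv I (fun t => C (y t)) (fun t => C (K t)) := by
  intro θ hθ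
  have := congrArg C (h θ hθ)
  rw [map_neg, ← C.integral_comp_comm (hθ.deriv.integrableOn_smul hy),
    ← C.integral_comp_comm (hθ.integrableOn_smul hK)] at this
  simpa only [map_smul] using this

/-- A bounded operator passes through both integrals, so an injective one can be cancelled. It is
used to remove `R ^ (s/2)`. -/
theorem IsWeakDeriv.of_map {I : Set ℝ} {y K : ℝ → H} {C : H →L[ℂ] H} (hC : Function.Injective C)
    (hy : LocallyIntegrableOn y I volume) (hK : LocallyIntegrableOn K I volume)
    (h : IsWeakDeriv I (fun t => C (y t)) (fun t => C (K t))) : IsWeakDeriv I y K := by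
  intro θ hθ
  apply hC
  rw [map_neg, ← C.integral_comp_comm (hθ.deriv.integrableOn_smul hy),
    ← C.integral_comp_comm (hθ.integrableOn_smul hK)]
  simpa only [map_smul] using h θ hθ

/-- Testing a weak derivative with a smooth curve of vectors. -/
theorem IsWeakDeriv.integral_inner_eq_zero [TopologicalSpace.SeparableSpace H] {I : Set ℝ} (hI : IsOpen I)
    {y K : ℝ → H} (h : IsWeakDeriv I y K)
    (hy : LocallyIntegrableOn y I volume) (hK : LocallyIntegrableOn K I volume)
    {ζ : ℝ → H} (hζ : ContDiffOn ℝ ∞ ζ I) {θ : ℝ → ℂ} (hθ : IsTimeTest I θ) :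
    ∫ t in I, (deriv θ t * inner ℂ (ζ t) (y t) + θ t * inner ℂ (deriv ζ t) (y t)
      + θ t * inner ℂ (ζ t) (K t)) = 0 := by
  obtain ⟨w, b, -⟩ := exists_hilbertBasis ℂ H
  have : Countable w := b.countable
  have hζ' : ContinuousOn (deriv ζ) I := hζ.continuousOn_deriv_of_isOpen hI (by simp)
  set G : w → ℝ → ℂ := fun i t =>
    deriv θ t * (inner ℂ (ζ t) (b i) * inner ℂ (b i) (y t))
      + θ t * (inner ℂ (deriv ζ t) (b i) * inner ℂ (b i) (y t))
      + θ t * (inner ℂ (ζ t) (b i) * inner ℂ (b i) (K t)) with hG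
  have hzero : ∀ i, IntegrableOn (G i) I volume ∧ ∫ t in I, G i t = 0 := by
    intro i
    -- The coefficient of `ζ` along `b i` is smooth on `I`, so its product with `θ` is again a
    -- scalar test function and the definition of the weak derivative applies to it.
    have hg : ContDiffOn ℝ ∞ (fun t => inner ℂ (ζ t) (b i)) I :=
      hζ.inner ℂ contDiffOn_const
    have hθi := hθ.mul_contDiffOn hI hg
    have hd : ∀ t ∈ I, deriv (fun t => θ t * inner ℂ (ζ t) (b i)) t =
        deriv θ t * inner ℂ (ζ t) (b i) + θ t * inner ℂ (deriv ζ t) (b i) := by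
      intro t ht
      have h1 : HasDerivAt ζ (deriv ζ t) t :=
        ((hζ.contDiffAt (hI.mem_nhds ht)).differentiableAt (by simp)).hasDerivAt
      have h2 : HasDerivAt θ (deriv θ t) t := (hθ.1.differentiable (by simp) t).hasDerivAt
      have h3 := h2.mul (h1.inner ℂ (hasDerivAt_const t (b i)))
      refine h3.deriv.trans ?_
      simp
    have e1 := hθi.deriv.integrableOn_smul hy
    have e2 := hθi.integrableOn_smul hK
    have e := congrArg (fun z => inner ℂ (b i) z) (h _ hθi)
    simp only [inner_neg_right] at e
    rw [← integral_inner e1, ← integral_inner e2, ← add_eq_zero_iff_eq_neg,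
      ← integral_add (e1.const_inner _) (e2.const_inner _)] at e
    have hcongr : ∀ t ∈ I, inner ℂ (b i) (deriv (fun t => θ t * inner ℂ (ζ t) (b i)) t • y t) +
        inner ℂ (b i) ((θ t * inner ℂ (ζ t) (b i)) • K t) = G i t := by
      intro t ht
      rw [hd t ht, inner_smul_right, inner_smul_right, hG]
      ring
    refine ⟨?_, ?_⟩
    · exact IntegrableOn.congr_fun ((e1.const_inner (b i)).add (e2.const_inner (b i))) hcongr
        hI.measurableSet
    · rw [← e]
      exact (setIntegral_congr_fun hI.measurableSet hcongr).symm
  have hbound : IntegrableOn (fun t => ‖deriv θ t * (‖ζ t‖ * ‖y t‖ : ℝ)‖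
      + ‖θ t * (‖deriv ζ t‖ * ‖y t‖ : ℝ)‖ + ‖θ t * (‖ζ t‖ * ‖K t‖ : ℝ)‖) I volume := by
    have loc : ∀ {f g : ℝ → H}, ContinuousOn f I → LocallyIntegrableOn g I volume →
        LocallyIntegrableOn (fun t => ((‖f t‖ * ‖g t‖ : ℝ) : ℂ)) I volume := by
      intro f g hf hg
      have h1 : LocallyIntegrableOn (fun t => ‖f t‖ * ‖g t‖) I volume :=
        hg.norm.continuousOn_mul hf.norm hI.isLocallyClosed
      exact Complex.ofRealCLM.locallyIntegrableOn_comp h1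
    exact ((hθ.deriv.integrableOn_mul (loc hζ.continuousOn hy)).norm.add
      (hθ.integrableOn_mul (loc hζ' hy)).norm).add
      (hθ.integrableOn_mul (loc hζ.continuousOn hK)).norm
  -- Parseval pointwise in `t`, then dominated convergence along finite sets of basis vectors;
  -- countability of the basis makes this filter countably generated.
  have hlim : Filter.Tendsto (fun s : Finset w => ∫ t in I, ∑ i ∈ s, G i t) Filter.atTop
      (nhds (∫ t in I, (deriv θ t * inner ℂ (ζ t) (y t) + θ t * inner ℂ (deriv ζ t) (y t)
        + θ t * inner ℂ (ζ t) (K t)))) := by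
    refine tendsto_integral_filter_of_dominated_convergence _
      (Filter.Eventually.of_forall fun s => ?_) (Filter.Eventually.of_forall fun s => ?_) hbound ?_
    · exact (integrable_finsetSum s fun i _ => (hzero i).1).aestronglyMeasurable
    · refine Filter.Eventually.of_forall fun t => ?_
      simp only [hG, Finset.sum_add_distrib, ← Finset.mul_sum]
      have key : ∀ (c : ℂ) (x z : H), ‖c * ∑ i ∈ s, inner ℂ x (b i) * inner ℂ (b i) z‖ ≤
          ‖c * (‖x‖ * ‖z‖ : ℝ)‖ := by
        intro c x z
        rw [norm_mul, norm_mul, Complex.norm_real, Real.norm_of_nonneg (by positivity)]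
        exact mul_le_mul_of_nonneg_left (b.norm_sum_inner_mul_inner_le s x z) (norm_nonneg c)
      exact (norm_add_le _ _).trans (add_le_add ((norm_add_le _ _).trans
        (add_le_add (key _ _ _) (key _ _ _))) (key _ _ _))
    · refine Filter.Eventually.of_forall fun t => ?_
      exact (((b.hasSum_inner_mul_inner _ _).mul_left _).add
        ((b.hasSum_inner_mul_inner _ _).mul_left _)).add
        ((b.hasSum_inner_mul_inner _ _).mul_left _)
  have hz : ∀ s : Finset w, ∫ t in I, ∑ i ∈ s, G i t = 0 := by
    intro s
    rw [integral_finsetSum s fun i _ => (hzero i).1]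
    exact Finset.sum_eq_zero fun i _ => (hzero i).2
  simp only [hz] at hlim
  exact tendsto_nhds_unique hlim tendsto_const_nhds

end WeakDeriv

/-! ### Graphs of partially defined operators -/

section Graphs

variable {X Y Z : Type*} [AddCommGroup X] [Module ℂ X] [AddCommGroup Y] [Module ℂ Y]
  [AddCommGroup Z] [Module ℂ Z]

theorem pApply_of_mem_graph {B : X →ₗ.[ℂ] Y} {f : X} {h : Y} (hf : (f, h) ∈ B.graph) :
    pApply B f = h := by
  obtain ⟨⟨g, hg⟩, rfl, rfl⟩ := (B.mem_graph_iff).1 hf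
  rw [pApply, dif_pos hg]

theorem mem_graph_pApply {B : X →ₗ.[ℂ] Y} {f : X} (hf : f ∈ B.domain) :
    (f, pApply B f) ∈ B.graph := by
  rw [pApply, dif_pos hf]
  exact B.mem_graph ⟨f, hf⟩

theorem mem_graph_pComp {B : Y →ₗ.[ℂ] Z} {D : X →ₗ.[ℂ] Y} {f : X} {h : Z} :
    (f, h) ∈ (pComp B D).graph ↔ ∃ g, (f, g) ∈ D.graph ∧ (g, h) ∈ B.graph := by
  simp only [LinearPMap.mem_graph_iff]
  constructor
  · rintro ⟨⟨f, hf⟩, rfl, rfl⟩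
    obtain ⟨⟨f, hf'⟩, hg, rfl⟩ := hf
    exact ⟨D ⟨f, hf'⟩, ⟨⟨f, hf'⟩, rfl, rfl⟩, ⟨_, hg⟩, rfl, rfl⟩
  · rintro ⟨g, ⟨f, rfl, rfl⟩, ⟨g, hg⟩, rfl, rfl⟩
    exact ⟨⟨f, f, hg, rfl⟩, rfl, rfl⟩

theorem mem_graph_everywhere {D : X →ₗ[ℂ] Y} {f : X} {h : Y} :
    (f, h) ∈ (everywhere D).graph ↔ D f = h := by
  simp only [LinearPMap.mem_graph_iff]
  exact ⟨by rintro ⟨f, rfl, rfl⟩; rfl, by rintro rfl; exact ⟨⟨f, trivial⟩, rfl, rfl⟩⟩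

theorem mem_graph_compPMap {D : Y →ₗ[ℂ] Z} {B : X →ₗ.[ℂ] Y} {f : X} {h : Z} :
    (f, h) ∈ (D.compPMap B).graph ↔ ∃ g, (f, g) ∈ B.graph ∧ D g = h := by
  simp only [LinearPMap.mem_graph_iff]
  constructor
  · rintro ⟨f, rfl, rfl⟩
    exact ⟨B f, ⟨f, rfl, rfl⟩, rfl⟩
  · rintro ⟨g, ⟨f, rfl, rfl⟩, rfl⟩
    exact ⟨f, rfl, rfl⟩

theorem mem_graph_add {A B : X →ₗ.[ℂ] Y} {f : X} {h : Y} :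
    (f, h) ∈ (A + B).graph ↔ ∃ a b, (f, a) ∈ A.graph ∧ (f, b) ∈ B.graph ∧ a + b = h := by
  simp only [LinearPMap.mem_graph_iff]
  constructor
  · rintro ⟨f, rfl, rfl⟩
    exact ⟨A ⟨f, f.2.1⟩, B ⟨f, f.2.2⟩, ⟨_, rfl, rfl⟩, ⟨_, rfl, rfl⟩, rfl⟩
  · rintro ⟨a, b, ⟨⟨f, hA⟩, rfl, rfl⟩, ⟨⟨f', hB⟩, h1, rfl⟩, rfl⟩
    obtain rfl : f' = f := h1
    exact ⟨⟨f', hA, hB⟩, rfl, rfl⟩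

theorem mem_graph_sub {A B : X →ₗ.[ℂ] Y} {f : X} {h : Y} :
    (f, h) ∈ (A - B).graph ↔ ∃ a b, (f, a) ∈ A.graph ∧ (f, b) ∈ B.graph ∧ a - b = h := by
  simp only [LinearPMap.mem_graph_iff]
  constructor
  · rintro ⟨f, rfl, rfl⟩
    exact ⟨A ⟨f, f.2.1⟩, B ⟨f, f.2.2⟩, ⟨_, rfl, rfl⟩, ⟨_, rfl, rfl⟩, rfl⟩
  · rintro ⟨a, b, ⟨⟨f, hA⟩, rfl, rfl⟩, ⟨⟨f', hB⟩, h1, rfl⟩, rfl⟩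
    obtain rfl : f' = f := h1
    exact ⟨⟨f', hA, hB⟩, rfl, rfl⟩

theorem mem_graph_neg {A : X →ₗ.[ℂ] Y} {f : X} {h : Y} :
    (f, h) ∈ (-A).graph ↔ (f, -h) ∈ A.graph := by
  simp only [LinearPMap.mem_graph_iff]
  constructor
  · rintro ⟨f, rfl, rfl⟩
    exact ⟨f, rfl, (neg_neg _).symm⟩
  · rintro ⟨f, rfl, hf⟩
    exact ⟨f, rfl, neg_eq_iff_eq_neg.2 hf⟩

theorem mem_graph_smul {A : X →ₗ.[ℂ] Y} {c : ℂ} {f : X} {h : Y} :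
    (f, h) ∈ (c • A).graph ↔ ∃ a, (f, a) ∈ A.graph ∧ c • a = h := by
  simp only [LinearPMap.mem_graph_iff]
  constructor
  · rintro ⟨f, rfl, rfl⟩
    exact ⟨A f, ⟨f, rfl, rfl⟩, rfl⟩
  · rintro ⟨a, ⟨f, rfl, rfl⟩, rfl⟩
    exact ⟨f, rfl, rfl⟩

end Graphs

/-! ### Tempered distributions given by square integrable functions -/

theorem toDist_apply (f : L2) (φ : 𝓢(Plane, ℂ)) : toDist f φ = ∫ x, φ x * f x := by
  change Lp.toTemperedDistribution f φ = _
  rw [Lp.toTemperedDistribution_apply]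
  rfl

theorem toDist_injective : Function.Injective toDist :=
  LinearMap.ker_eq_bot.1 (Lp.ker_toTemperedDistributionCLM_eq_bot (F := ℂ)
    (μ := (volume : Measure Plane)) (p := 2))

theorem mem_graph_mulOp {m : Plane → ℂ} {f h : L2} :
    (f, h) ∈ (mulOp m).graph ↔ ∀ᵐ x, h x = m x * f x := by
  unfold mulOp
  rw [Submodule.toLinearPMap_graph_eq]
  · rfl
  · rintro ⟨f, h⟩ (hp : ∀ᵐ x, h x = m x * f x) (rfl : f = 0)
    refine Lp.ext ?_
    filter_upwards [hp, Lp.coeFn_zero ℂ 2 (volume : Measure Plane)] with x h1 h2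
    rw [h1, h2, Pi.zero_apply, mul_zero]

theorem mem_graph_l2Part {D : 𝓢'(Plane, ℂ) →ₗ[ℂ] 𝓢'(Plane, ℂ)} {f h : L2} :
    (f, h) ∈ (l2Part D).graph ↔ D (toDist f) = toDist h := by
  unfold l2Part
  rw [Submodule.toLinearPMap_graph_eq]
  · rfl
  · rintro ⟨f, h⟩ (hp : D (toDist f) = toDist h) (rfl : f = 0)
    rw [map_zero, map_zero] at hp
    exact toDist_injective (by rw [← hp, map_zero])

/-! ### Multiplication by bounded functions -/

/-- Multiplication by a bounded measurable function in `L²`. -/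
def mulBdd (m : Plane → ℂ) (C : ℝ) (hm : AEStronglyMeasurable m volume) (hC : ∀ x, ‖m x‖ ≤ C) :
    L2 →L[ℂ] L2 :=
  have hmem : ∀ f : L2, MemLp (fun x => m x * f x) 2 volume := fun f =>
    (Lp.memLp f).of_le_mul (c := C) (hm.mul (Lp.aestronglyMeasurable f))
      (Filter.Eventually.of_forall fun x => by
        rw [norm_mul]
        exact mul_le_mul_of_nonneg_right (hC x) (norm_nonneg _))
  LinearMap.mkContinuous
    { toFun := fun f => (hmem f).toLp _
      map_add' := fun f g => Lp.ext (by
        filter_upwards [(hmem (f + g)).coeFn_toLp, (hmem f).coeFn_toLp, (hmem g).coeFn_toLp,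
          Lp.coeFn_add f g, Lp.coeFn_add ((hmem f).toLp _) ((hmem g).toLp _)] with x h1 h2 h3 h4 h5
        rw [h1, h5, Pi.add_apply, h2, h3, h4, Pi.add_apply, mul_add])
      map_smul' := fun c f => Lp.ext (by
        filter_upwards [(hmem (c • f)).coeFn_toLp, (hmem f).coeFn_toLp,
          Lp.coeFn_smul c f, Lp.coeFn_smul c ((hmem f).toLp _)] with x h1 h2 h3 h4
        rw [h1, RingHom.id_apply, h4, Pi.smul_apply, h2, h3, Pi.smul_apply, smul_eq_mul,
          smul_eq_mul, mul_left_comm]) }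
    C (fun f => Lp.norm_le_mul_norm_of_ae_le_mul (by
        filter_upwards [(hmem f).coeFn_toLp] with x h1
        change ‖((hmem f).toLp _ : L2) x‖ ≤ _
        rw [h1, norm_mul]
        exact mul_le_mul_of_nonneg_right (hC x) (norm_nonneg _)))

section MulBdd

variable {m : Plane → ℂ} {C : ℝ} (hm : AEStronglyMeasurable m volume) (hC : ∀ x, ‖m x‖ ≤ C)

theorem coeFn_mulBdd (f : L2) : ∀ᵐ x, mulBdd m C hm hC f x = m x * f x := by
  have hmem : MemLp (fun x => m x * f x) 2 volume :=
    (Lp.memLp f).of_le_mul (c := C) (hm.mul (Lp.aestronglyMeasurable f))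
      (Filter.Eventually.of_forall fun x => by
        rw [norm_mul]
        exact mul_le_mul_of_nonneg_right (hC x) (norm_nonneg _))
  exact hmem.coeFn_toLp

theorem mem_graph_mulOp_iff_mulBdd {f h : L2} :
    (f, h) ∈ (mulOp m).graph ↔ mulBdd m C hm hC f = h := by
  rw [mem_graph_mulOp]
  constructor
  · intro hf
    refine Lp.ext ?_
    filter_upwards [hf, coeFn_mulBdd hm hC f] with x h1 h2
    rw [h1, h2]
  · rintro rfl
    exact coeFn_mulBdd hm hC f

end MulBdd

theorem mulBdd_ofReal_nonneg {v : Plane → ℝ} {C : ℝ}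
    (hm : AEStronglyMeasurable (fun x => (v x : ℂ)) volume) (hC : ∀ x, ‖(v x : ℂ)‖ ≤ C)
    (h0 : ∀ x, 0 ≤ v x) : 0 ≤ mulBdd (fun x => (v x : ℂ)) C hm hC := by
  rw [ContinuousLinearMap.nonneg_iff_isPositive, ContinuousLinearMap.isPositive_iff_complex]
  intro f
  have h1 : inner ℂ (mulBdd (fun x => (v x : ℂ)) C hm hC f) f =
      ((∫ x, v x * ‖f x‖ ^ 2 : ℝ) : ℂ) := by
    rw [L2.inner_def, ← integral_complex_ofReal]
    refine integral_congr_ae ?_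
    filter_upwards [coeFn_mulBdd hm hC f] with x hx
    rw [hx, RCLike.inner_apply, map_mul, Complex.conj_ofReal, mul_left_comm, Complex.mul_conj']
    push_cast
    rfl
  rw [h1]
  exact ⟨rfl, integral_nonneg fun x => mul_nonneg (h0 x) (sq_nonneg _)⟩

/-! ### The resolvents of `-Δ` and `-Δ + V` -/

/-- The symbol of `1 - Δ`. -/
def lapSymbol (x : Plane) : ℝ := 1 + ‖(2 * Real.pi) • x‖ ^ 2

theorem one_le_lapSymbol (x : Plane) : 1 ≤ lapSymbol x :=
  le_add_of_nonneg_right (sq_nonneg _)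

theorem hasTemperateGrowth_lapSymbol :
    Function.HasTemperateGrowth fun x : Plane => (lapSymbol x : ℂ) := by
  have h1 : Function.HasTemperateGrowth fun x : Plane => (2 * Real.pi) • x :=
    ((2 * Real.pi) • ContinuousLinearMap.id ℝ Plane).hasTemperateGrowth
  have h2 : Function.HasTemperateGrowth fun x : Plane => lapSymbol x :=
    (Function.HasTemperateGrowth.const (1 : ℝ)).add
      ((Function.hasTemperateGrowth_norm_sq (H := Plane)).comp h1)
  exact Function.Complex.hasTemperateGrowth_ofReal.comp h2

theorem hasTemperateGrowth_lapSymbol_inv :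
    Function.HasTemperateGrowth fun x : Plane => (((lapSymbol x)⁻¹ : ℝ) : ℂ) := by
  have h1 : Function.HasTemperateGrowth fun x : Plane => (2 * Real.pi) • x :=
    ((2 * Real.pi) • ContinuousLinearMap.id ℝ Plane).hasTemperateGrowth
  have h2 : Function.HasTemperateGrowth fun x : Plane => (lapSymbol x)⁻¹ := by
    have := (Function.hasTemperateGrowth_one_add_norm_sq_rpow Plane (-1)).comp h1
    simp only [Function.comp_def, Real.rpow_neg_one] at this
    exact this
  exact Function.Complex.hasTemperateGrowth_ofReal.comp h2

theorem norm_lapSymbol_inv_le (x : Plane) : ‖(((lapSymbol x)⁻¹ : ℝ) : ℂ)‖ ≤ 1 := by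
  rw [Complex.norm_real, Real.norm_of_nonneg (inv_nonneg.2 (zero_le_one.trans (one_le_lapSymbol x)))]
  exact inv_le_one_of_one_le₀ (one_le_lapSymbol x)

/-- Multiplication by the inverse of the symbol of `1 - Δ`. -/
def mulSymbolInv : L2 →L[ℂ] L2 :=
  mulBdd (fun x => (((lapSymbol x)⁻¹ : ℝ) : ℂ)) 1
    hasTemperateGrowth_lapSymbol_inv.1.continuous.aestronglyMeasurable norm_lapSymbol_inv_le

open FourierTransform

/-- The unitary Fourier transform on `L²`. -/
def fourierL2 : L2 ≃ₗᵢ[ℂ] L2 := Lp.fourierTransformₗᵢ Plane ℂ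

theorem toDist_fourierL2 (f : L2) : toDist (fourierL2 f) = 𝓕 (toDist f) :=
  (Lp.fourier_toTemperedDistribution_eq f).symm

theorem toDist_mulBdd {m : Plane → ℂ} {C : ℝ} (hm : AEStronglyMeasurable m volume)
    (hC : ∀ x, ‖m x‖ ≤ C) (hg : m.HasTemperateGrowth) (f : L2) :
    toDist (mulBdd m C hm hC f) = TemperedDistribution.smulLeftCLM ℂ m (toDist f) := by
  ext φ
  rw [TemperedDistribution.smulLeftCLM_apply_apply, toDist_apply, toDist_apply]
  refine integral_congr_ae ?_
  filter_upwards [coeFn_mulBdd hm hC f] with x hx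
  rw [hx, SchwartzMap.smulLeftCLM_apply_apply hg, smul_eq_mul]
  ring

/-- `(1 - Δ)⁻¹` as a Fourier multiplier. -/
def freeResolvent : L2 →L[ℂ] L2 :=
  (fourierL2.symm : L2 →L[ℂ] L2) ∘L mulSymbolInv ∘L (fourierL2 : L2 →L[ℂ] L2)

theorem fourier_one_sub_laplacian (T : 𝓢'(Plane, ℂ)) :
    𝓕 (T - lapDist T) =
      TemperedDistribution.smulLeftCLM ℂ (fun x : Plane => (lapSymbol x : ℂ)) (𝓕 T) := by
  have h1 : lapDist T = Δ T := TemperedDistribution.laplacianCLM_apply T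
  have h2 : (fun x : Plane => (lapSymbol x : ℂ)) =
      (fun _ : Plane => (1 : ℂ)) + ((2 * Real.pi) ^ 2 : ℂ) • fun x : Plane => ((‖x‖ ^ 2 : ℝ) : ℂ) := by
    ext x
    simp only [lapSymbol, norm_smul, Pi.add_apply, Pi.smul_apply, smul_eq_mul]
    rw [mul_pow, Real.norm_eq_abs, sq_abs]
    push_cast
    rfl
  have h3 : Function.HasTemperateGrowth fun x : Plane => ((‖x‖ ^ 2 : ℝ) : ℂ) :=
    Function.Complex.hasTemperateGrowth_ofReal.comp (Function.hasTemperateGrowth_norm_sq (H := Plane))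
  rw [h2, TemperedDistribution.smulLeftCLM_add (Function.HasTemperateGrowth.const 1)
    (show Function.HasTemperateGrowth (((2 * Real.pi) ^ 2 : ℂ) • fun x : Plane => ((‖x‖ ^ 2 : ℝ) : ℂ))
      from (Function.HasTemperateGrowth.const ((2 * Real.pi) ^ 2 : ℂ)).mul h3),
    TemperedDistribution.smulLeftCLM_smul h3, h1,
    TemperedDistribution.laplacian_eq_fourierMultiplierCLM,
    TemperedDistribution.fourierMultiplierCLM_apply]
  have h4 : ∀ S : 𝓢'(Plane, ℂ), 𝓕 S = FourierTransform.fourierEquiv ℂ 𝓢'(Plane, ℂ) S := fun _ => rfl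
  -- The multiplier formula for `Δ` carries a real scalar, while `𝓕` is used here as a complex
  -- linear map.
  have h5 : ∀ S : 𝓢'(Plane, ℂ), -(2 * Real.pi) ^ 2 • S = -(((2 * Real.pi) ^ 2 : ℂ) • S) := by
    intro S
    ext φ
    change (-(2 * Real.pi) ^ 2 : ℝ) • S φ = -(((2 * Real.pi) ^ 2 : ℂ) * S φ)
    rw [Complex.real_smul]
    push_cast
    ring
  rw [h5, h4, map_sub, map_neg, map_smul, ← h4, ← h4, FourierTransform.fourier_fourierInv_eq,
    sub_neg_eq_add, add_apply, smul_apply,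
    TemperedDistribution.smulLeftCLM_const, one_smul]

/-- The Fourier transform makes `1 - Δ` multiplication by a symbol `≥ 1`. The equivalence is checked
among tempered distributions, where the symbol and its inverse are mutually inverse multipliers, so
the domain of `Δ` needs no description. -/
theorem isResolvent_free : IsResolvent (-l2Part lapDist) freeResolvent := by
  have h0 : 0 ≤ freeResolvent := by
    have hM : 0 ≤ mulSymbolInv := mulBdd_ofReal_nonneg _ _ fun x =>
      inv_nonneg.2 (zero_le_one.trans (one_le_lapSymbol x))
    rw [ContinuousLinearMap.nonneg_iff_isPositive, ContinuousLinearMap.isPositive_iff_complex]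
      at hM ⊢
    intro f
    have : inner ℂ (freeResolvent f) f =
        inner ℂ (mulSymbolInv (fourierL2 f)) (fourierL2 f) := by
      rw [← fourierL2.inner_map_map (freeResolvent f)]
      congr 1
      exact fourierL2.apply_symm_apply _
    rw [this]
    exact hM _
  refine ⟨fun f g => ?_, ?_, ?_⟩
  · have e1 : (g, f - g) ∈ (-l2Part lapDist).graph ↔
        toDist f = toDist g - lapDist (toDist g) := by
      rw [mem_graph_neg, mem_graph_l2Part, neg_sub, map_sub, eq_sub_iff_add_eq, eq_sub_iff_add_eq,
        add_comm]
    have e2 : freeResolvent f = g ↔ mulSymbolInv (fourierL2 f) = fourierL2 g :=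
      fourierL2.symm_apply_eq
    have e3 : mulSymbolInv (fourierL2 f) = fourierL2 g ↔
        TemperedDistribution.smulLeftCLM ℂ (fun x : Plane => (((lapSymbol x)⁻¹ : ℝ) : ℂ))
          (𝓕 (toDist f)) = 𝓕 (toDist g) := by
      rw [← toDist_injective.eq_iff, mulSymbolInv, toDist_mulBdd _ _
        hasTemperateGrowth_lapSymbol_inv, toDist_fourierL2, toDist_fourierL2]
    have e4 : toDist f = toDist g - lapDist (toDist g) ↔ 𝓕 (toDist f) =
        TemperedDistribution.smulLeftCLM ℂ (fun x : Plane => (lapSymbol x : ℂ)) (𝓕 (toDist g)) := by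
      rw [← fourier_one_sub_laplacian]
      exact (FourierTransform.fourierEquiv ℂ 𝓢'(Plane, ℂ)).injective.eq_iff.symm
    have h1 : (fun x : Plane => (lapSymbol x : ℂ)) * (fun x => (((lapSymbol x)⁻¹ : ℝ) : ℂ)) =
        fun _ => 1 := by
      ext x
      have := (zero_lt_one.trans_le (one_le_lapSymbol x)).ne'
      rw [Pi.mul_apply, ← Complex.ofReal_mul, mul_inv_cancel₀ this, Complex.ofReal_one]
    rw [e1, e2, e3, e4]
    constructor
    · intro h
      rw [← h, TemperedDistribution.smulLeftCLM_smulLeftCLM_apply hasTemperateGrowth_lapSymbol_inv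
        hasTemperateGrowth_lapSymbol, mul_comm, h1, TemperedDistribution.smulLeftCLM_const, one_smul]
    · intro h
      rw [h, TemperedDistribution.smulLeftCLM_smulLeftCLM_apply hasTemperateGrowth_lapSymbol
        hasTemperateGrowth_lapSymbol_inv, h1, TemperedDistribution.smulLeftCLM_const, one_smul]
  · exact h0
  -- For a nonnegative element of a C⋆-algebra, `≤ 1` is the same as norm at most `1`.
  · refine (CStarAlgebra.norm_le_one_iff_of_nonneg _ h0).1 ?_
    refine ContinuousLinearMap.opNorm_le_bound _ zero_le_one fun f => ?_
    calc ‖freeResolvent f‖ = ‖mulSymbolInv (fourierL2 f)‖ := fourierL2.symm.norm_map _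
      _ ≤ 1 * ‖fourierL2 f‖ := by
        refine Lp.norm_le_mul_norm_of_ae_le_mul ?_
        filter_upwards [coeFn_mulBdd _ norm_lapSymbol_inv_le (fourierL2 f)] with x hx
        rw [mulSymbolInv, hx, norm_mul]
        exact mul_le_mul_of_nonneg_right (norm_lapSymbol_inv_le x) (norm_nonneg _)
      _ = 1 * ‖f‖ := by rw [fourierL2.norm_map]

/-! ### The Schrödinger operator with a bounded potential -/

/-- A bounded, nonnegative, measurable potential, bounded by `C`. -/
structure IsPotential (V : Plane → ℝ) (C : ℝ) : Prop where
  aestronglyMeasurable : AEStronglyMeasurable (fun x => (V x : ℂ)) (volume : Measure Plane)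
  norm_le : ∀ x, ‖(V x : ℂ)‖ ≤ C
  nonneg : ∀ x, 0 ≤ V x

namespace IsPotential

variable {V : Plane → ℝ} {C : ℝ}

/-- Multiplication by the potential. -/
def op (hV : IsPotential V C) : L2 →L[ℂ] L2 :=
  mulBdd (fun x => (V x : ℂ)) C hV.aestronglyMeasurable hV.norm_le

theorem mem_graph_mulOp (hV : IsPotential V C) {f h : L2} :
    (f, h) ∈ (mulOp (fun x => (V x : ℂ))).graph ↔ hV.op f = h :=
  mem_graph_mulOp_iff_mulBdd _ _

theorem op_nonneg (hV : IsPotential V C) : 0 ≤ hV.op :=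
  mulBdd_ofReal_nonneg _ _ hV.nonneg

/-- For bounded `V` the domain condition `V g ∈ L²` is automatic; only the distributional equation
remains. -/
theorem mem_graph_neg_deltaV (hV : IsPotential V C) {g k : L2} :
    (g, k) ∈ (-deltaV V).graph ↔ lapDist (toDist g) = toDist (hV.op g - k) := by
  rw [deltaV, mem_graph_neg, mem_graph_sub]
  simp only [mem_graph_l2Part, hV.mem_graph_mulOp]
  constructor
  · rintro ⟨a, b, h1, rfl, h2⟩
    rw [h1, sub_eq_add_neg, ← h2, add_sub_cancel]
  · intro h
    exact ⟨_, _, h, rfl, by abel⟩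

theorem exists_isResolvent (hV : IsPotential V C) : ∃ R, IsResolvent (-deltaV V) R := by
  refine isResolvent_free.exists_of_add hV.op_nonneg fun g k => ?_
  rw [hV.mem_graph_neg_deltaV, mem_graph_neg, mem_graph_l2Part, neg_sub]

/-- `(1 - Δ + V)⁻¹`. -/
def res (hV : IsPotential V C) : L2 →L[ℂ] L2 := hV.exists_isResolvent.choose

theorem isResolvent (hV : IsPotential V C) : IsResolvent (-deltaV V) hV.res :=
  hV.exists_isResolvent.choose_spec

theorem lapDist_res (hV : IsPotential V C) (f : L2) :
    lapDist (toDist (hV.res f)) = toDist (hV.op (hV.res f) + hV.res f - f) := by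
  have := hV.mem_graph_neg_deltaV.1 ((hV.isResolvent.apply_eq_iff f _).1 rfl)
  rw [this]
  congr 1
  abel

theorem res_eq_of_lapDist (hV : IsPotential V C) {f g : L2}
    (h : toDist g - lapDist (toDist g) + toDist (hV.op g) = toDist f) : hV.res f = g := by
  rw [hV.isResolvent.apply_eq_iff, hV.mem_graph_neg_deltaV, map_sub, map_sub, ← h]
  abel

end IsPotential

/-! ### Multiplication by Gaussian phases -/

/-- The function `exp (-i τ |x|² / 2)`; thus `phase t = gaussPhase t⁻¹`. -/
def gaussPhase (τ : ℝ) (x : Plane) : ℂ :=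
  Complex.exp (Complex.I * ((-(τ / 2) * ‖x‖ ^ 2 : ℝ) : ℂ))

/-- In the parameter `τ = 1/t` the phases form a one-parameter unitary group. The convention `1/0 =
0` makes the identity hold at `t = 0` too. -/
theorem phase_eq_gaussPhase (t : ℝ) : phase t = gaussPhase t⁻¹ := by
  ext x
  rw [phase, gaussPhase]
  congr 1
  rw [div_mul_eq_div_div, div_eq_mul_inv (Complex.I / 2)]
  push_cast
  ring

theorem norm_gaussPhase (τ : ℝ) (x : Plane) : ‖gaussPhase τ x‖ = 1 := by
  rw [gaussPhase, mul_comm, Complex.norm_exp_ofReal_mul_I]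

theorem gaussPhase_zero (x : Plane) : gaussPhase 0 x = 1 := by
  simp [gaussPhase]

theorem gaussPhase_add (σ τ : ℝ) (x : Plane) :
    gaussPhase (σ + τ) x = gaussPhase σ x * gaussPhase τ x := by
  rw [gaussPhase, gaussPhase, gaussPhase, ← Complex.exp_add]
  congr 1
  push_cast
  ring

theorem hasTemperateGrowth_exp_I_mul :
    Function.HasTemperateGrowth fun r : ℝ => Complex.exp (Complex.I * (r : ℂ)) := by
  have hd : ∀ n : ℕ, iteratedDeriv n (fun r : ℝ => Complex.exp (Complex.I * (r : ℂ))) =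
      fun r : ℝ => Complex.I ^ n * Complex.exp (Complex.I * (r : ℂ)) := by
    intro n
    induction n with
    | zero => simp
    | succ n ih =>
      rw [iteratedDeriv_succ, ih]
      ext r
      have h1 : HasDerivAt (fun r : ℝ => Complex.I * (r : ℂ)) (Complex.I * 1) r :=
        (Complex.ofRealCLM.hasDerivAt).const_mul Complex.I
      rw [(h1.cexp.const_mul (Complex.I ^ n)).deriv]
      ring
  refine ⟨(contDiff_const.mul Complex.ofRealCLM.contDiff).cexp, fun n => ⟨0, 1, fun x => ?_⟩⟩
  rw [norm_iteratedFDeriv_eq_norm_iteratedDeriv, hd, norm_mul, norm_pow, Complex.norm_I, one_pow,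
    mul_comm Complex.I, Complex.norm_exp_ofReal_mul_I]
  simp

theorem hasTemperateGrowth_gaussPhase (τ : ℝ) : (gaussPhase τ).HasTemperateGrowth := by
  have h : Function.HasTemperateGrowth fun x : Plane => -(τ / 2) * ‖x‖ ^ 2 :=
    (Function.HasTemperateGrowth.const (-(τ / 2))).mul (Function.hasTemperateGrowth_norm_sq (H := Plane))
  exact hasTemperateGrowth_exp_I_mul.comp h

theorem hasTemperateGrowth_normSq :
    Function.HasTemperateGrowth fun x : Plane => ((‖x‖ ^ 2 : ℝ) : ℂ) :=
  Function.Complex.hasTemperateGrowth_ofReal.comp (Function.hasTemperateGrowth_norm_sq (H := Plane))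

theorem hasTemperateGrowth_coord (j : Fin 2) :
    Function.HasTemperateGrowth fun x : Plane => ((x j : ℝ) : ℂ) :=
  Function.Complex.hasTemperateGrowth_ofReal.comp
    (EuclideanSpace.proj (𝕜 := ℝ) j : Plane →L[ℝ] ℝ).hasTemperateGrowth

/-- Multiplication by `gaussPhase τ` in `L²`. -/
def gaussOp (τ : ℝ) : L2 →L[ℂ] L2 :=
  mulBdd (gaussPhase τ) 1 (hasTemperateGrowth_gaussPhase τ).1.continuous.aestronglyMeasurable
    fun x => (norm_gaussPhase τ x).le

theorem coeFn_gaussOp (τ : ℝ) (f : L2) : ∀ᵐ x, gaussOp τ f x = gaussPhase τ x * f x :=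
  coeFn_mulBdd _ _ f

theorem mem_graph_phaseOp {t : ℝ} {f h : L2} :
    (f, h) ∈ (phaseOp t).graph ↔ gaussOp t⁻¹ f = h := by
  rw [phaseOp, phase_eq_gaussPhase]
  exact mem_graph_mulOp_iff_mulBdd _ _

theorem gaussOp_zero (f : L2) : gaussOp 0 f = f := by
  refine Lp.ext ?_
  filter_upwards [coeFn_gaussOp 0 f] with x hx
  rw [hx, gaussPhase_zero, one_mul]

theorem gaussOp_gaussOp (σ τ : ℝ) (f : L2) : gaussOp σ (gaussOp τ f) = gaussOp (σ + τ) f := by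
  refine Lp.ext ?_
  filter_upwards [coeFn_gaussOp σ (gaussOp τ f), coeFn_gaussOp τ f, coeFn_gaussOp (σ + τ) f]
    with x h1 h2 h3
  rw [h1, h2, h3, gaussPhase_add, mul_assoc]

theorem gaussOp_neg_gaussOp (τ : ℝ) (f : L2) : gaussOp (-τ) (gaussOp τ f) = f := by
  rw [gaussOp_gaussOp, neg_add_cancel, gaussOp_zero]

theorem gaussOp_gaussOp_neg (τ : ℝ) (f : L2) : gaussOp τ (gaussOp (-τ) f) = f := by
  rw [gaussOp_gaussOp, add_neg_cancel, gaussOp_zero]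

theorem norm_gaussOp (τ : ℝ) (f : L2) : ‖gaussOp τ f‖ = ‖f‖ := by
  have h : ∀ (τ : ℝ) (f : L2), ‖gaussOp τ f‖ ≤ ‖f‖ := by
    intro τ f
    refine Lp.norm_le_norm_of_ae_le ?_
    filter_upwards [coeFn_gaussOp τ f] with x hx
    rw [hx, norm_mul, norm_gaussPhase, one_mul]
  refine le_antisymm (h τ f) ?_
  calc ‖f‖ = ‖gaussOp (-τ) (gaussOp τ f)‖ := by rw [gaussOp_neg_gaussOp]
    _ ≤ _ := h _ _

theorem conj_gaussPhase (τ : ℝ) (x : Plane) :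
    (starRingEnd ℂ) (gaussPhase τ x) = gaussPhase (-τ) x := by
  rw [gaussPhase, gaussPhase, ← Complex.exp_conj, map_mul, Complex.conj_I, Complex.conj_ofReal]
  congr 1
  push_cast
  ring

theorem inner_gaussOp_left (τ : ℝ) (f g : L2) :
    inner ℂ (gaussOp τ f) g = inner ℂ f (gaussOp (-τ) g) := by
  rw [L2.inner_def, L2.inner_def]
  refine integral_congr_ae ?_
  filter_upwards [coeFn_gaussOp τ f, coeFn_gaussOp (-τ) g] with x h1 h2
  rw [h1, h2, RCLike.inner_apply, RCLike.inner_apply, map_mul, conj_gaussPhase]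
  ring

theorem IsPotential.op_gaussOp {V : Plane → ℝ} {C : ℝ} (hV : IsPotential V C) (τ : ℝ) (f : L2) :
    hV.op (gaussOp τ f) = gaussOp τ (hV.op f) := by
  refine Lp.ext ?_
  filter_upwards [coeFn_mulBdd hV.aestronglyMeasurable hV.norm_le (gaussOp τ f),
    coeFn_mulBdd hV.aestronglyMeasurable hV.norm_le f, coeFn_gaussOp τ f,
    coeFn_gaussOp τ (hV.op f)] with x h1 h2 h3 h4
  rw [h4]
  change mulBdd _ _ hV.aestronglyMeasurable hV.norm_le (gaussOp τ f) x =
    _ * mulBdd _ _ hV.aestronglyMeasurable hV.norm_le f x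
  rw [h1, h2, h3]
  ring

/-! ### Schwartz functions as test vectors -/

/-- The vector `conj φ` of `L²`, which represents the functional `f ↦ ∫ φ f`. -/
def testVec (φ : 𝓢(Plane, ℂ)) : L2 := star (φ.toLp 2)

theorem coeFn_testVec (φ : 𝓢(Plane, ℂ)) : ∀ᵐ x, testVec φ x = (starRingEnd ℂ) (φ x) := by
  filter_upwards [Lp.coeFn_star (φ.toLp 2 : L2), φ.coeFn_toLp 2 (volume : Measure Plane)]
    with x h1 h2
  rw [testVec, h1, Pi.star_apply, h2]
  rfl

theorem inner_testVec (φ : 𝓢(Plane, ℂ)) (f : L2) : inner ℂ (testVec φ) f = toDist f φ := by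
  rw [L2.inner_def, toDist_apply]
  refine integral_congr_ae ?_
  filter_upwards [coeFn_testVec φ] with x hx
  rw [hx, RCLike.inner_apply, Complex.conj_conj, mul_comm]

theorem testVec_add (φ ψ : 𝓢(Plane, ℂ)) : testVec (φ + ψ) = testVec φ + testVec ψ :=
  ext_inner_right ℂ fun f => by simp only [inner_add_left, inner_testVec, map_add]

theorem testVec_sub (φ ψ : 𝓢(Plane, ℂ)) : testVec (φ - ψ) = testVec φ - testVec ψ :=
  ext_inner_right ℂ fun f => by simp only [inner_sub_left, inner_testVec, map_sub]

theorem testVec_smul (c : ℂ) (φ : 𝓢(Plane, ℂ)) :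
    testVec (c • φ) = (starRingEnd ℂ) c • testVec φ :=
  ext_inner_right ℂ fun f => by
    rw [inner_smul_left, Complex.conj_conj, inner_testVec, inner_testVec, map_smul, smul_eq_mul]

/-- Multiplication of Schwartz functions by `gaussPhase τ`. -/
abbrev gaussS (τ : ℝ) : 𝓢(Plane, ℂ) →L[ℂ] 𝓢(Plane, ℂ) := SchwartzMap.smulLeftCLM ℂ (gaussPhase τ)

/-- Multiplication of Schwartz functions by `|x|²`. -/
abbrev normSqS : 𝓢(Plane, ℂ) →L[ℂ] 𝓢(Plane, ℂ) :=
  SchwartzMap.smulLeftCLM ℂ fun x : Plane => ((‖x‖ ^ 2 : ℝ) : ℂ)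

theorem toDist_gaussOp (τ : ℝ) (f : L2) (φ : 𝓢(Plane, ℂ)) :
    toDist (gaussOp τ f) φ = toDist f (gaussS τ φ) := by
  rw [gaussOp, toDist_mulBdd _ _ (hasTemperateGrowth_gaussPhase τ)]
  rfl

theorem testVec_gaussS (τ : ℝ) (φ : 𝓢(Plane, ℂ)) :
    testVec (gaussS τ φ) = gaussOp (-τ) (testVec φ) :=
  ext_inner_right ℂ fun f => by
    rw [inner_gaussOp_left, neg_neg, inner_testVec, inner_testVec, toDist_gaussOp]

theorem dense_range_testVec : Dense (range testVec) := by
  rw [Metric.dense_iff]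
  intro f r hr
  have hd := SchwartzMap.denseRange_toLpCLM (E := Plane) (F := ℂ) (p := 2)
    (μ := (volume : Measure Plane)) ENNReal.ofNat_ne_top
  obtain ⟨φ, hφ⟩ := Metric.denseRange_iff.1 hd (star f) r hr
  refine ⟨testVec φ, ?_, φ, rfl⟩
  rw [Metric.mem_ball, dist_comm]
  refine lt_of_le_of_lt ?_ hφ
  rw [dist_eq_norm, dist_eq_norm]
  refine Lp.norm_le_norm_of_ae_le ?_
  filter_upwards [coeFn_testVec φ, Lp.coeFn_sub f (testVec φ),
    Lp.coeFn_sub (star f) (SchwartzMap.toLpCLM ℝ ℂ 2 volume φ), Lp.coeFn_star f,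
    φ.coeFn_toLp 2 (volume : Measure Plane)] with x h1 h2 h3 h4 h5
  rw [h2, h3, Pi.sub_apply, Pi.sub_apply, h1, h4, Pi.star_apply, SchwartzMap.toLpCLM_apply, h5,
    ← norm_star (f x - _), star_sub]
  change ‖_ - (starRingEnd ℂ) ((starRingEnd ℂ) (φ x))‖ ≤ _
  rw [Complex.conj_conj]

/-! ### Smooth and continuous dependence on the Gaussian parameter -/

theorem norm_exp_I_mul_sub_one_sub_le (y : ℝ) :
    ‖Complex.exp (Complex.I * y) - 1 - Complex.I * y‖ ≤ 2 * y ^ 2 := by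
  have hy : ‖Complex.I * (y : ℂ)‖ = |y| := by simp
  rcases le_or_gt |y| 1 with h | h
  · have := Complex.norm_exp_sub_one_sub_id_le (hy.trans_le h)
    rw [hy, sq_abs] at this
    nlinarith [sq_nonneg y]
  · calc ‖Complex.exp (Complex.I * y) - 1 - Complex.I * y‖
        ≤ ‖Complex.exp (Complex.I * y) - 1‖ + ‖Complex.I * (y : ℂ)‖ := norm_sub_le _ _
      _ ≤ |y| + |y| := add_le_add Real.norm_exp_I_mul_ofReal_sub_one_le hy.le
      _ ≤ 2 * y ^ 2 := by
        rw [← sq_abs]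
        nlinarith

/-- The Taylor remainder of `exp (i y)` at `y = -h |x|² / 2` is at most `2 y² = (h² / 2) |x|⁴` for
every `x`. Against the Schwartz function `φ` this is `O(h²)` in `L²`. -/
theorem hasDerivAt_gaussOp_testVec_zero (φ : 𝓢(Plane, ℂ)) :
    HasDerivAt (fun τ : ℝ => gaussOp (-τ) (testVec φ)) ((Complex.I / 2) • testVec (normSqS φ)) 0 := by
  have key : ∀ h : ℝ, ‖gaussOp (-h) (testVec φ) - testVec φ
      - h • ((Complex.I / 2) • testVec (normSqS φ))‖ ≤
      (h ^ 2 / 2) * ‖testVec (normSqS (normSqS φ))‖ := by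
    intro h
    have e1 : h • ((Complex.I / 2) • testVec (normSqS φ)) =
        testVec ((-(Complex.I / 2) * h) • normSqS φ) := by
      rw [testVec_smul, RCLike.real_smul_eq_coe_smul (K := ℂ) h, smul_smul]
      congr 1
      change (h : ℂ) * _ = _
      simp only [map_mul, map_neg, map_div₀, Complex.conj_I, Complex.conj_ofReal, map_ofNat]
      ring
    rw [e1, ← testVec_gaussS, ← testVec_sub, ← testVec_sub]
    refine Lp.norm_le_mul_norm_of_ae_le_mul ?_
    filter_upwards [coeFn_testVec (gaussS h φ - φ - (-(Complex.I / 2) * (h : ℂ)) • normSqS φ),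
      coeFn_testVec (normSqS (normSqS φ))] with x h1 h2
    rw [h1, h2, RCLike.norm_conj, RCLike.norm_conj, sub_apply, sub_apply,
      smul_apply, SchwartzMap.smulLeftCLM_apply_apply (hasTemperateGrowth_gaussPhase h),
      SchwartzMap.smulLeftCLM_apply_apply hasTemperateGrowth_normSq,
      SchwartzMap.smulLeftCLM_apply_apply hasTemperateGrowth_normSq,
      SchwartzMap.smulLeftCLM_apply_apply hasTemperateGrowth_normSq]
    have h3 := norm_exp_I_mul_sub_one_sub_le (-(h / 2) * ‖x‖ ^ 2)
    have h4 : gaussPhase h x • φ x - φ x -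
        (-(Complex.I / 2) * (h : ℂ)) • ((‖x‖ ^ 2 : ℝ) : ℂ) • φ x =
        (Complex.exp (Complex.I * ((-(h / 2) * ‖x‖ ^ 2 : ℝ) : ℂ)) - 1 -
          Complex.I * ((-(h / 2) * ‖x‖ ^ 2 : ℝ) : ℂ)) * φ x := by
      simp only [gaussPhase, smul_eq_mul]
      push_cast
      ring
    rw [h4, norm_mul, smul_eq_mul, smul_eq_mul, norm_mul, norm_mul, Complex.norm_real,
      Real.norm_of_nonneg (sq_nonneg ‖x‖), ← mul_assoc, ← mul_assoc]
    refine mul_le_mul_of_nonneg_right (h3.trans (le_of_eq ?_)) (norm_nonneg _)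
    ring
  rw [hasDerivAt_iff_isLittleO_nhds_zero]
  have h0 : (fun h : ℝ => gaussOp (-(0 + h)) (testVec φ) - gaussOp (-0) (testVec φ)
      - h • ((Complex.I / 2) • testVec (normSqS φ))) =O[nhds 0] fun h : ℝ => h ^ 2 := by
    refine Asymptotics.IsBigO.of_bound (‖testVec (normSqS (normSqS φ))‖ / 2)
      (Filter.Eventually.of_forall fun h => ?_)
    rw [zero_add, neg_zero, gaussOp_zero, Real.norm_of_nonneg (sq_nonneg h)]
    exact (key h).trans (le_of_eq (by ring))
  exact h0.trans_isLittleO (Asymptotics.isLittleO_pow_id one_lt_two)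

/-- The group law transports the derivative from `0` to `τ`. -/
theorem hasDerivAt_gaussOp_testVec (φ : 𝓢(Plane, ℂ)) (τ : ℝ) :
    HasDerivAt (fun τ : ℝ => gaussOp (-τ) (testVec φ))
      ((Complex.I / 2) • gaussOp (-τ) (testVec (normSqS φ))) τ := by
  have h1 : HasDerivAt (fun r : ℝ => gaussOp (-(r - τ)) (testVec φ))
      ((Complex.I / 2) • testVec (normSqS φ)) τ := by
    have := hasDerivAt_gaussOp_testVec_zero φ
    rw [← sub_self τ] at this
    exact HasDerivAt.comp_sub_const τ τ this
  have h2 := ((gaussOp (-τ)).restrictScalars ℝ).hasFDerivAt.comp_hasDerivAt τ h1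
  have h3 : (fun r : ℝ => gaussOp (-r) (testVec φ)) =
      ((gaussOp (-τ)).restrictScalars ℝ) ∘ fun r : ℝ => gaussOp (-(r - τ)) (testVec φ) := by
    ext1 r
    change _ = gaussOp (-τ) (gaussOp (-(r - τ)) (testVec φ))
    rw [gaussOp_gaussOp]
    congr 2
    ring
  rw [h3]
  refine h2.congr_deriv ?_
  change gaussOp (-τ) ((Complex.I / 2) • testVec (normSqS φ)) = _
  rw [map_smul]

/-- The derivative is a curve of the same kind with `|x|² φ` in place of `φ`, so the induction runs
over all `φ` at once. -/
theorem contDiff_gaussOp_testVec (φ : 𝓢(Plane, ℂ)) :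
    ContDiff ℝ ∞ (fun τ : ℝ => gaussOp (-τ) (testVec φ)) := by
  rw [contDiff_infty]
  intro n
  induction n generalizing φ with
  | zero =>
    rw [Nat.cast_zero, contDiff_zero]
    exact continuous_iff_continuousAt.2 fun τ => (hasDerivAt_gaussOp_testVec φ τ).continuousAt
  | succ n ih =>
    rw [Nat.cast_succ, contDiff_succ_iff_deriv]
    refine ⟨fun τ => (hasDerivAt_gaussOp_testVec φ τ).differentiableAt, by simp, ?_⟩
    have : deriv (fun τ : ℝ => gaussOp (-τ) (testVec φ)) =
        fun τ => (Complex.I / 2) • gaussOp (-τ) (testVec (normSqS φ)) :=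
      funext fun τ => (hasDerivAt_gaussOp_testVec φ τ).deriv
    rw [this]
    exact (ih (normSqS φ)).const_smul _

/-- Isometries that depend continuously on `τ` on a dense set are jointly continuous. This yields
measurability of `t ↦ M(t) f(t)`. -/
theorem continuous_gaussOp : Continuous fun p : ℝ × L2 => gaussOp p.1 p.2 := by
  refine continuous_prod_of_dense_continuous_lipschitzWith' _ 1 dense_range_testVec
    (fun τ => ?_) ?_
  · refine LipschitzWith.of_dist_le_mul fun f g => ?_
    rw [dist_eq_norm, ← map_sub, norm_gaussOp, NNReal.coe_one, one_mul, dist_eq_norm]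
  · rintro - ⟨φ, rfl⟩
    have := (contDiff_gaussOp_testVec φ).continuous.comp continuous_neg
    simpa only [Function.comp_def, neg_neg] using this

theorem locallyIntegrableOn_of_isometric_curve {E : Type*} [NormedAddCommGroup E]
    [NormedSpace ℂ E] {W : ℝ → E →L[ℂ] E} (hc : Continuous fun p : ℝ × E => W p.1 p.2)
    (hn : ∀ r x, ‖W r x‖ = ‖x‖) {I : Set ℝ} (hI : IsOpen I) {f : ℝ → E}
    (hf : LocallyIntegrableOn f I volume) {τ : ℝ → ℝ} (hτ : Measurable τ) :
    LocallyIntegrableOn (fun t => W (τ t) (f t)) I volume := by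
  rw [locallyIntegrableOn_iff hI.isLocallyClosed]
  intro k hkI hk
  have hfk := hf.integrableOn_compact_subset hkI hk
  have hm : AEStronglyMeasurable (fun t => (τ t, f t)) (volume.restrict k) :=
    hτ.aestronglyMeasurable.prodMk hfk.aestronglyMeasurable
  exact Integrable.mono hfk (hc.comp_aestronglyMeasurable hm)
    (Filter.Eventually.of_forall fun t => (hn _ _).le)

theorem locallyIntegrableOn_gaussOp {I : Set ℝ} (hI : IsOpen I) {f : ℝ → L2}
    (hf : LocallyIntegrableOn f I volume) {τ : ℝ → ℝ} (hτ : Measurable τ) :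
    LocallyIntegrableOn (fun t => gaussOp (τ t) (f t)) I volume :=
  locallyIntegrableOn_of_isometric_curve continuous_gaussOp norm_gaussOp hI hf hτ

/-! ### Calculus with Schwartz functions -/

/-- Multiplication of Schwartz functions by the coordinate `x_j`. -/
abbrev coordS (j : Fin 2) : 𝓢(Plane, ℂ) →L[ℂ] 𝓢(Plane, ℂ) :=
  SchwartzMap.smulLeftCLM ℂ fun x : Plane => ((x j : ℝ) : ℂ)

/-- The partial derivative of Schwartz functions in direction `j`. -/
abbrev partialS (j : Fin 2) : 𝓢(Plane, ℂ) →L[ℂ] 𝓢(Plane, ℂ) :=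
  LineDeriv.lineDerivOpCLM ℂ 𝓢(Plane, ℂ) (EuclideanSpace.single j (1 : ℝ))

/-- The operator `x · ∇` on Schwartz functions. -/
def eulerS : 𝓢(Plane, ℂ) →L[ℂ] 𝓢(Plane, ℂ) := ∑ j : Fin 2, coordS j ∘L partialS j

theorem eulerS_apply (φ : 𝓢(Plane, ℂ)) : eulerS φ = ∑ j : Fin 2, coordS j (partialS j φ) := by
  simp [eulerS]

theorem partialS_smulLeftCLM {g g' : Plane → ℂ} (j : Fin 2) (hg : g.HasTemperateGrowth)
    (hg' : g'.HasTemperateGrowth)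
    (h : ∀ x, HasLineDerivAt ℝ g (g' x) x (EuclideanSpace.single j (1 : ℝ))) (φ : 𝓢(Plane, ℂ)) :
    partialS j (SchwartzMap.smulLeftCLM ℂ g φ) =
      SchwartzMap.smulLeftCLM ℂ g (partialS j φ) + SchwartzMap.smulLeftCLM ℂ g' φ := by
  ext x
  have h1 : HasLineDerivAt ℝ φ (partialS j φ x) x (EuclideanSpace.single j (1 : ℝ)) := by
    have := (φ.hasFDerivAt x).hasLineDerivAt (EuclideanSpace.single j (1 : ℝ))
    exact this
  have h2 : HasLineDerivAt ℝ (SchwartzMap.smulLeftCLM ℂ g φ)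
      (g' x * φ x + g x * partialS j φ x) x (EuclideanSpace.single j (1 : ℝ)) := by
    have h3 := HasDerivAt.mul (h x) h1
    simp only [zero_smul, add_zero] at h3
    rw [SchwartzMap.smulLeftCLM_apply hg]
    exact h3
  have h4 : partialS j (SchwartzMap.smulLeftCLM ℂ g φ) x =
      lineDeriv ℝ (SchwartzMap.smulLeftCLM ℂ g φ) x (EuclideanSpace.single j (1 : ℝ)) :=
    SchwartzMap.lineDerivOp_apply _ _ _
  rw [h4, h2.lineDeriv, add_apply, SchwartzMap.smulLeftCLM_apply_apply hg,
    SchwartzMap.smulLeftCLM_apply_apply hg', smul_eq_mul, smul_eq_mul, add_comm]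

theorem partialS_coordS (j : Fin 2) (φ : 𝓢(Plane, ℂ)) :
    partialS j (coordS j φ) = coordS j (partialS j φ) + φ := by
  rw [partialS_smulLeftCLM (g' := fun _ => 1) j (hasTemperateGrowth_coord j)
    (Function.HasTemperateGrowth.const 1), SchwartzMap.smulLeftCLM_const]
  · simp
  · intro x
    have h1 : HasFDerivAt (fun x : Plane => ((x j : ℝ) : ℂ))
        (Complex.ofRealCLM ∘L (EuclideanSpace.proj j : Plane →L[ℝ] ℝ)) x :=
      (Complex.ofRealCLM ∘L (EuclideanSpace.proj j : Plane →L[ℝ] ℝ)).hasFDerivAt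
    simpa using h1.hasLineDerivAt (EuclideanSpace.single j (1 : ℝ))

theorem gaussS_coordS (τ : ℝ) (j : Fin 2) (φ : 𝓢(Plane, ℂ)) :
    gaussS τ (coordS j φ) = coordS j (gaussS τ φ) := by
  rw [SchwartzMap.smulLeftCLM_smulLeftCLM_apply (hasTemperateGrowth_gaussPhase τ)
    (hasTemperateGrowth_coord j), SchwartzMap.smulLeftCLM_smulLeftCLM_apply
    (hasTemperateGrowth_coord j) (hasTemperateGrowth_gaussPhase τ), mul_comm]

theorem hasLineDerivAt_gaussPhase (τ : ℝ) (j : Fin 2) (x : Plane) :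
    HasLineDerivAt ℝ (gaussPhase τ) (gaussPhase τ x * (-(Complex.I * τ) * ((x j : ℝ) : ℂ))) x
      (EuclideanSpace.single j (1 : ℝ)) := by
  have h1 : HasFDerivAt (fun x : Plane => ‖x‖ ^ 2) (2 • (innerSL ℝ x)) x :=
    (hasStrictFDerivAt_norm_sq x).hasFDerivAt
  have h2 : HasLineDerivAt ℝ (fun x : Plane => ‖x‖ ^ 2) (2 * x j) x
      (EuclideanSpace.single j (1 : ℝ)) := by
    have := h1.hasLineDerivAt (EuclideanSpace.single j (1 : ℝ))
    simpa [EuclideanSpace.inner_single_right] using this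
  have h3 := (((HasDerivAt.const_mul (-(τ / 2)) h2).ofReal_comp).const_mul Complex.I).cexp
  simp only [zero_smul, add_zero] at h3
  refine HasDerivAt.congr_deriv h3 ?_
  rw [gaussPhase]
  push_cast
  ring

theorem partialS_gaussS (τ : ℝ) (j : Fin 2) (φ : 𝓢(Plane, ℂ)) :
    partialS j (gaussS τ φ) = gaussS τ (partialS j φ - (Complex.I * τ) • coordS j φ) := by
  have hg : Function.HasTemperateGrowth fun x : Plane => -(Complex.I * (τ : ℂ)) * ((x j : ℝ) : ℂ) :=
    (Function.HasTemperateGrowth.const _).mul (hasTemperateGrowth_coord j)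
  have hgg : Function.HasTemperateGrowth fun x : Plane =>
      gaussPhase τ x * (-(Complex.I * (τ : ℂ)) * ((x j : ℝ) : ℂ)) :=
    (hasTemperateGrowth_gaussPhase τ).mul hg
  rw [partialS_smulLeftCLM j (hasTemperateGrowth_gaussPhase τ) hgg
    (hasLineDerivAt_gaussPhase τ j), map_sub, sub_eq_add_neg]
  congr 1
  ext x
  rw [SchwartzMap.smulLeftCLM_apply_apply hgg, neg_apply,
    SchwartzMap.smulLeftCLM_apply_apply (hasTemperateGrowth_gaussPhase τ), smul_apply,
    SchwartzMap.smulLeftCLM_apply_apply (hasTemperateGrowth_coord j)]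
  simp only [smul_eq_mul]
  ring

theorem normSqS_eq (φ : 𝓢(Plane, ℂ)) : normSqS φ = ∑ j : Fin 2, coordS j (coordS j φ) := by
  ext x
  rw [SchwartzMap.smulLeftCLM_apply_apply hasTemperateGrowth_normSq, Fin.sum_univ_two, add_apply,
    SchwartzMap.smulLeftCLM_apply_apply (hasTemperateGrowth_coord 0),
    SchwartzMap.smulLeftCLM_apply_apply (hasTemperateGrowth_coord 0),
    SchwartzMap.smulLeftCLM_apply_apply (hasTemperateGrowth_coord 1),
    SchwartzMap.smulLeftCLM_apply_apply (hasTemperateGrowth_coord 1), EuclideanSpace.norm_sq_eq,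
    Fin.sum_univ_two]
  simp only [smul_eq_mul, Real.norm_eq_abs, sq_abs]
  push_cast
  ring

theorem laplacianS_eq (φ : 𝓢(Plane, ℂ)) : Δ φ = ∑ j : Fin 2, partialS j (partialS j φ) := by
  rw [SchwartzMap.laplacian_eq_sum (EuclideanSpace.basisFun (Fin 2) ℝ)]
  simp

/-- Conjugation of `x · ∇` with a Gaussian phase. -/
theorem eulerS_gaussS (τ : ℝ) (φ : 𝓢(Plane, ℂ)) :
    eulerS (gaussS τ φ) = gaussS τ (eulerS φ - (Complex.I * τ) • normSqS φ) := by
  rw [eulerS_apply, eulerS_apply, normSqS_eq]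
  simp only [partialS_gaussS, ← gaussS_coordS, Fin.sum_univ_two, map_add, map_sub, map_smul]
  module

/-- Conjugation of `Δ` with a Gaussian phase. -/
theorem laplacianS_gaussS (τ : ℝ) (φ : 𝓢(Plane, ℂ)) :
    Δ (gaussS τ φ) = gaussS τ (Δ φ - (2 * (Complex.I * τ)) • (eulerS φ + φ)
      - ((τ : ℂ) ^ 2) • normSqS φ) := by
  have h : Complex.I * Complex.I = -1 := Complex.I_mul_I
  rw [laplacianS_eq, laplacianS_eq, normSqS_eq, eulerS_apply]
  simp only [partialS_gaussS, ← map_sum]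
  congr 1
  -- Each of the two coordinates contributes one `φ` through `∂ⱼ xⱼ = xⱼ ∂ⱼ + 1`; hence `x · ∇ + 1`
  -- with coefficient `2 i τ`.
  simp only [Fin.sum_univ_two, map_sub, map_smul, partialS_coordS]
  have h2 : (Complex.I * (τ : ℂ)) * (Complex.I * τ) = -(τ : ℂ) ^ 2 := by
    linear_combination (τ : ℂ) ^ 2 * h
  simp only [smul_sub, smul_smul, h2]
  module

/-- The transpose of `x · ∇` is `-(x · ∇ + 2)`. -/
theorem eulerDist_apply (T : 𝓢'(Plane, ℂ)) (φ : 𝓢(Plane, ℂ)) :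
    eulerDist T φ = -T (eulerS φ + (2 : ℂ) • φ) := by
  have h1 : eulerDist T φ = -∑ j : Fin 2, T (partialS j (coordS j φ)) := by
    rw [← Finset.sum_neg_distrib]
    change (∑ j : Fin 2, (TemperedDistribution.smulLeftCLM ℂ (fun x : Plane => ((x j : ℝ) : ℂ))) ∘L
      (LineDeriv.lineDerivOpCLM ℂ 𝓢'(Plane, ℂ) (EuclideanSpace.single j (1 : ℝ)))) T φ = _
    rw [Fin.sum_univ_two, Fin.sum_univ_two]
    change T (-partialS 0 (coordS 0 φ)) + T (-partialS 1 (coordS 1 φ)) = _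
    rw [map_neg, map_neg]
  rw [h1, ← map_sum, eulerS_apply]
  simp only [partialS_coordS, Fin.sum_univ_two]
  congr 2
  module

theorem lapDist_apply (T : 𝓢'(Plane, ℂ)) (φ : 𝓢(Plane, ℂ)) : lapDist T φ = T (Δ φ) := by
  have h1 : lapDist T = Δ T := TemperedDistribution.laplacianCLM_apply T
  rw [h1, TemperedDistribution.laplacian_apply_apply]

theorem phaseDist_apply (t : ℝ) (T : 𝓢'(Plane, ℂ)) (φ : 𝓢(Plane, ℂ)) :
    phaseDist t T φ = T (gaussS t⁻¹ φ) := by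
  rw [phaseDist, phase_eq_gaussPhase]
  rfl

/-! ### The vectors `conj ((1 - Δ + V) φ)` -/

section Helmholtz

variable {V : Plane → ℝ} {C : ℝ} (hV : IsPotential V C)

namespace IsPotential

/-- The vector `conj ((1 - Δ + V) φ)` of `L²`. -/
def helmVec (φ : 𝓢(Plane, ℂ)) : L2 := testVec φ - testVec (Δ φ) + hV.op (testVec φ)

theorem inner_op (f g : L2) : inner ℂ (hV.op f) g = inner ℂ f (hV.op g) :=
  ((ContinuousLinearMap.nonneg_iff_isPositive _).1 hV.op_nonneg).inner_left_eq_inner_right f g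

theorem inner_res (f g : L2) : inner ℂ (hV.res f) g = inner ℂ f (hV.res g) :=
  ((ContinuousLinearMap.nonneg_iff_isPositive _).1
    hV.isResolvent.nonneg).inner_left_eq_inner_right f g

theorem inner_helmVec (φ : 𝓢(Plane, ℂ)) (f : L2) :
    inner ℂ (hV.helmVec φ) f =
      (toDist f - lapDist (toDist f) + toDist (hV.op f)) φ := by
  rw [helmVec, inner_add_left, inner_sub_left, hV.inner_op, inner_testVec, inner_testVec,
    inner_testVec, ← lapDist_apply]
  rfl

/-- By symmetry of `R`, this is `(1 - Δ + V) R f = f` in the sense of distributions, tested with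
`φ`. -/
theorem res_helmVec (φ : 𝓢(Plane, ℂ)) : hV.res (hV.helmVec φ) = testVec φ :=
  ext_inner_right ℂ fun f => by
    rw [hV.inner_res, hV.inner_helmVec, inner_testVec, hV.lapDist_res, map_sub, map_add]
    congr 1
    abel

/-- Orthogonality to all these vectors says `(1 - Δ + V) f = 0` as a distribution, hence `f = R 0 =
0`: the vectors are total. -/
theorem eq_zero_of_inner_helmVec {f : L2} (h : ∀ φ, inner ℂ (hV.helmVec φ) f = 0) : f = 0 := by
  have := hV.res_eq_of_lapDist (f := 0) (g := f) (by
    ext φ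
    rw [← hV.inner_helmVec, h, map_zero]
    rfl)
  rw [← this, map_zero]

theorem mem_graph_deltaVDist {f : L2} {T : 𝓢'(Plane, ℂ)} :
    (f, T) ∈ (deltaVDist V).graph ↔ lapDist (toDist f) - toDist (hV.op f) = T := by
  simp only [deltaVDist, mem_graph_sub, mem_graph_everywhere, mem_graph_compPMap,
    hV.mem_graph_mulOp]
  constructor
  · rintro ⟨a, b, rfl, ⟨g, rfl, rfl⟩, rfl⟩
    rfl
  · rintro rfl
    exact ⟨_, _, rfl, ⟨_, rfl, rfl⟩, rfl⟩

theorem pApply_deltaVDist (f : L2) (φ : 𝓢(Plane, ℂ)) :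
    pApply (deltaVDist V) f φ = inner ℂ (testVec φ - hV.helmVec φ) f := by
  rw [pApply_of_mem_graph (hV.mem_graph_deltaVDist.2 rfl), inner_sub_left, hV.inner_helmVec,
    inner_testVec]
  change _ = toDist f φ - (toDist f φ - lapDist (toDist f) φ + toDist (hV.op f) φ)
  change lapDist (toDist f) φ - toDist (hV.op f) φ = _
  ring

theorem mem_graph_resV {f g : L2} : (f, g) ∈ (resV V).graph ↔ hV.res f = g := by
  rw [resV, mem_graph_everywhere, hV.isResolvent.resolventOne_eq]
  rfl

theorem mem_graph_extendV {B : L2 →ₗ.[ℂ] L2} {f : L2} {T : 𝓢'(Plane, ℂ)} :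
    (f, T) ∈ (extendV V B).graph ↔ ∃ g, (hV.res f, g) ∈ B.graph ∧
      toDist g - lapDist (toDist g) + toDist (hV.op g) = T := by
  simp only [extendV, mem_graph_pComp, mem_graph_sub, mem_graph_everywhere,
    hV.mem_graph_deltaVDist, hV.mem_graph_resV]
  constructor
  · rintro ⟨g, ⟨_, rfl, hg⟩, _, _, rfl, rfl, rfl⟩
    exact ⟨g, hg, by abel⟩
  · rintro ⟨g, hg, rfl⟩
    exact ⟨g, ⟨_, rfl, hg⟩, _, _, rfl, rfl, by abel⟩

theorem schrodinger_eq (I : Set ℝ) (w : ℝ → L2) (θ : ℝ → ℂ) (φ : 𝓢(Plane, ℂ)) :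
    schrodinger V I w θ φ =
      Complex.I * (∫ t in I, -deriv θ t * inner ℂ (testVec φ) (w t)) +
        (1 / 2) * ∫ t in I, θ t * inner ℂ (testVec φ - hV.helmVec φ) (w t) := by
  simp only [schrodinger, timeDist, hV.pApply_deltaVDist, inner_testVec]

/-! ### Test curves obtained from Gaussian phases -/

theorem helmVec_gaussS (τ : ℝ) (φ : 𝓢(Plane, ℂ)) :
    hV.helmVec (gaussS τ φ) = gaussOp (-τ) (hV.helmVec φ
      - (2 * (Complex.I * τ)) • testVec (eulerS φ + φ)
      + ((τ : ℂ) ^ 2) • testVec (normSqS φ)) := by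
  have h1 : (starRingEnd ℂ) (2 * (Complex.I * τ)) = -(2 * (Complex.I * τ)) := by
    simp only [map_mul, Complex.conj_I, Complex.conj_ofReal, map_ofNat]
    ring
  have h2 : (starRingEnd ℂ) ((τ : ℂ) ^ 2) = (τ : ℂ) ^ 2 := by
    simp only [map_pow, Complex.conj_ofReal]
  rw [helmVec, laplacianS_gaussS, testVec_gaussS, testVec_gaussS, hV.op_gaussOp, testVec_sub,
    testVec_sub, testVec_smul, testVec_smul, h1, h2, ← map_sub, ← map_add, helmVec]
  congr 1
  module

theorem inner_helmVec_gaussS (τ : ℝ) (φ : 𝓢(Plane, ℂ)) (f : L2) :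
    inner ℂ (hV.helmVec (gaussS τ φ)) f =
      inner ℂ (hV.helmVec φ) (gaussOp τ f)
        + 2 * (Complex.I * τ) * inner ℂ (testVec (eulerS φ + φ)) (gaussOp τ f)
        + (τ : ℂ) ^ 2 * inner ℂ (testVec (normSqS φ)) (gaussOp τ f) := by
  rw [hV.helmVec_gaussS, inner_gaussOp_left, neg_neg, inner_add_left, inner_sub_left,
    inner_smul_left, inner_smul_left]
  simp only [map_mul, map_pow, Complex.conj_I, Complex.conj_ofReal, map_ofNat]
  ring

theorem inner_testVec_gaussS (τ : ℝ) (φ : 𝓢(Plane, ℂ)) (f : L2) :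
    inner ℂ (testVec (gaussS τ φ)) f = inner ℂ (testVec φ) (gaussOp τ f) := by
  rw [testVec_gaussS, inner_gaussOp_left, neg_neg]

/-- After conjugation the curve is a combination of smooth curves `gaussOp (-τ) (testVec ψ)`, and
`hV.op` of one of them, with coefficients polynomial in `τ`. -/
theorem contDiff_helmVec_gaussS (φ : 𝓢(Plane, ℂ)) :
    ContDiff ℝ ∞ fun τ : ℝ => hV.helmVec (gaussS τ φ) := by
  have h1 := contDiff_gaussOp_testVec φ
  have h2 := contDiff_gaussOp_testVec (Δ φ)
  have h3 := contDiff_gaussOp_testVec (eulerS φ + φ)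
  have h4 := contDiff_gaussOp_testVec (normSqS φ)
  have hI : ContDiff ℝ ∞ fun τ : ℝ => 2 * (Complex.I * (τ : ℂ)) :=
    contDiff_const.mul (contDiff_const.mul Complex.ofRealCLM.contDiff)
  have hQ : ContDiff ℝ ∞ fun τ : ℝ => (τ : ℂ) ^ 2 := Complex.ofRealCLM.contDiff.pow 2
  have h5 : ContDiff ℝ ∞ fun τ : ℝ => hV.op (gaussOp (-τ) (testVec φ)) :=
    (hV.op.restrictScalars ℝ).contDiff.comp h1
  have h6 : (fun τ : ℝ => hV.helmVec (gaussS τ φ)) = fun τ : ℝ =>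
      gaussOp (-τ) (testVec φ) - gaussOp (-τ) (testVec (Δ φ)) + hV.op (gaussOp (-τ) (testVec φ))
        - (2 * (Complex.I * (τ : ℂ))) • gaussOp (-τ) (testVec (eulerS φ + φ))
        + ((τ : ℂ) ^ 2) • gaussOp (-τ) (testVec (normSqS φ)) := by
    ext1 τ
    rw [hV.helmVec_gaussS, map_add, map_sub, map_smul, map_smul, helmVec, map_add, map_sub,
      hV.op_gaussOp]
  rw [h6]
  exact (((h1.sub h2).add h5).sub (hI.smul h3)).add (hQ.smul h4)

/-- Used with `c = 1` for `M(t)` and with `c = -1` for `M(-t)`. -/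
theorem contDiffOn_inv_curve {I : Set ℝ} (hI : I ⊆ Ioi 0) (c : ℝ) (φ : 𝓢(Plane, ℂ)) :
    ContDiffOn ℝ ∞ (fun t : ℝ => hV.helmVec (gaussS (c * t⁻¹) φ)) I := by
  refine (hV.contDiff_helmVec_gaussS φ).comp_contDiffOn (f := fun t : ℝ => c * t⁻¹) ?_
  exact contDiffOn_const.mul (contDiffOn_id.inv fun t ht => (hI ht).ne')

theorem res_deriv {I : Set ℝ} (hI : IsOpen I) {ζ : ℝ → L2} (hζ : ContDiffOn ℝ ∞ ζ I) {t : ℝ}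
    (ht : t ∈ I) {d : L2} (hd : HasDerivAt (fun r => hV.res (ζ r)) d t) :
    hV.res (deriv ζ t) = d := by
  have h1 : HasDerivAt ζ (deriv ζ t) t :=
    ((hζ.contDiffAt (hI.mem_nhds ht)).differentiableAt (by simp)).hasDerivAt
  exact HasDerivAt.unique ((hV.res.restrictScalars ℝ).hasFDerivAt.comp_hasDerivAt t h1) hd

theorem hasDerivAt_res_helmVec (c : ℝ) (φ : 𝓢(Plane, ℂ)) {t : ℝ} (ht : t ≠ 0) :
    HasDerivAt (fun r : ℝ => hV.res (hV.helmVec (gaussS (c * r⁻¹) φ)))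
      (((-c * (t⁻¹) ^ 2 : ℝ) : ℂ) • (Complex.I / 2) • testVec (gaussS (c * t⁻¹) (normSqS φ))) t := by
  simp only [hV.res_helmVec, testVec_gaussS]
  have h1 : HasDerivAt (fun r : ℝ => c * r⁻¹) (-c * (t⁻¹) ^ 2) t := by
    refine ((hasDerivAt_inv ht).const_mul c).congr_deriv ?_
    rw [inv_pow]
    ring
  have h2 := (hasDerivAt_gaussOp_testVec φ (c * t⁻¹)).scomp t h1
  exact h2

/-- Because `ζ'` is paired only with vectors `R f`, it is enough to differentiate `R ζ = conj (M
φ)`, where just the `|x|²` term of the phase appears. -/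
theorem inner_deriv_curve {I : Set ℝ} (hI : IsOpen I) (hI0 : I ⊆ Ioi 0) (c : ℝ)
    (φ : 𝓢(Plane, ℂ)) {t : ℝ} (ht : t ∈ I) (f : L2) :
    inner ℂ (deriv (fun r : ℝ => hV.helmVec (gaussS (c * r⁻¹) φ)) t) (hV.res f) =
      c * (t : ℂ)⁻¹ ^ 2 * (Complex.I / 2) *
        inner ℂ (testVec (normSqS φ)) (gaussOp (c * t⁻¹) f) := by
  rw [← hV.inner_res, hV.res_deriv hI (hV.contDiffOn_inv_curve hI0 c φ) ht
    (hV.hasDerivAt_res_helmVec c φ (hI0 ht).ne'), inner_smul_left, inner_smul_left,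
    inner_testVec_gaussS]
  simp only [map_div₀, Complex.conj_I, Complex.conj_ofReal, map_ofNat]
  push_cast
  ring

end IsPotential

end Helmholtz

/-! ### The evolution equation as a weak derivative -/

theorem IsWeakDeriv.congr_ae {H : Type*} [NormedAddCommGroup H] [InnerProductSpace ℂ H]
    {I : Set ℝ} {y K y' K' : ℝ → H} (h : IsWeakDeriv I y K)
    (hy : ∀ᵐ t ∂(volume.restrict I), y t = y' t) (hK : ∀ᵐ t ∂(volume.restrict I), K t = K' t) :
    IsWeakDeriv I y' K' := by
  intro θ hθ
  have h1 : ∫ t in I, deriv θ t • y t = ∫ t in I, deriv θ t • y' t :=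
    integral_congr_ae (by filter_upwards [hy] with t ht; rw [ht])
  have h2 : ∫ t in I, θ t • K t = ∫ t in I, θ t • K' t :=
    integral_congr_ae (by filter_upwards [hK] with t ht; rw [ht])
  rw [← h1, ← h2]
  exact h θ hθ

theorem continuousOn_ofReal_inv {I : Set ℝ} (hI : I ⊆ Ioi 0) :
    ContinuousOn (fun t : ℝ => ((t : ℂ))⁻¹) I :=
  Complex.continuous_ofReal.continuousOn.inv₀ fun t ht => by exact_mod_cast (hI ht).ne'

theorem locallyIntegrableOn_const_inner {H : Type*} [NormedAddCommGroup H] [InnerProductSpace ℂ H]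
    {I : Set ℝ} (hI : IsOpen I) (a : H) {y : ℝ → H} (hy : LocallyIntegrableOn y I volume) :
    LocallyIntegrableOn (fun t => inner ℂ a (y t)) I volume :=
  hy.inner_continuousOn hI continuousOn_const

theorem inner_integral_add {H : Type*} [NormedAddCommGroup H] [InnerProductSpace ℂ H]
    [CompleteSpace H] {I : Set ℝ} (a : H) {y K : ℝ → H} (hy : IntegrableOn y I volume)
    (hK : IntegrableOn K I volume) :
    inner ℂ a ((∫ t in I, y t) + ∫ t in I, K t) = ∫ t in I, (inner ℂ a (y t) + inner ℂ a (K t)) := by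
  rw [inner_add_right, ← integral_inner hy, ← integral_inner hK,
    ← integral_add (hy.const_inner _) (hK.const_inner _)]

theorem separableSpace_L2 : TopologicalSpace.SeparableSpace L2 :=
  haveI : Fact ((2 : ENNReal) ≠ ⊤) := ⟨by simp⟩
  haveI : SecondCountableTopology L2 := inferInstance
  inferInstance

namespace IsPotential

variable {V : Plane → ℝ} {C : ℝ} (hV : IsPotential V C) {I : Set ℝ}

theorem isWeakDeriv_of_inner_helmVec {y K : ℝ → L2}
    (hy : LocallyIntegrableOn y I volume) (hK : LocallyIntegrableOn K I volume)
    (h : ∀ φ θ, IsTimeTest I θ → ∫ t in I, (deriv θ t * inner ℂ (hV.helmVec φ) (y t) +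
      θ t * inner ℂ (hV.helmVec φ) (K t)) = 0) : IsWeakDeriv I y K := by
  intro θ hθ
  rw [← add_eq_zero_iff_eq_neg]
  refine hV.eq_zero_of_inner_helmVec fun φ => ?_
  have e1 := hθ.deriv.integrableOn_smul hy
  have e2 := hθ.integrableOn_smul hK
  refine (inner_integral_add _ e1 e2).trans ?_
  rw [← h φ θ hθ]
  simp only [inner_smul_right]

/-- The right-hand side of the regularized equation `i ∂ₜ (R u) = R F - ½ Δ_V R u`. -/
def resRhs (u F : ℝ → L2) (t : ℝ) : L2 :=
  -Complex.I • (hV.res (F t) - (1 / 2 : ℂ) • (hV.res (u t) - u t))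

theorem locallyIntegrableOn_resRhs {u F : ℝ → L2} (hu : LocallyIntegrableOn u I volume)
    (hF : LocallyIntegrableOn F I volume) : LocallyIntegrableOn (hV.resRhs u F) I volume :=
  ((hV.res.locallyIntegrableOn_comp hF).sub
    (((hV.res.locallyIntegrableOn_comp hu).sub hu).smul (1 / 2 : ℂ))).smul (-Complex.I)

/-- Pairing with `h_φ` removes `R`, as `⟨h_φ, R f⟩ = ⟨conj φ, f⟩`, and leaves `i` times the given
equation tested with `φ`. -/
theorem isWeakDeriv_res (hI : IsOpen I) {u F : ℝ → L2} (hu : LocallyIntegrableOn u I volume)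
    (hF : LocallyIntegrableOn F I volume)
    (huF : ∀ θ, IsTimeTest I θ → ∀ φ : 𝓢(Plane, ℂ),
      schrodinger V I u θ φ = timeDist I (fun t => toDist (F t)) θ φ) :
    IsWeakDeriv I (fun t => hV.res (u t)) (hV.resRhs u F) := by
  refine hV.isWeakDeriv_of_inner_helmVec (hV.res.locallyIntegrableOn_comp hu)
    (hV.locallyIntegrableOn_resRhs hu hF) fun φ θ hθ => ?_
  have h := huF θ hθ φ
  rw [hV.schrodinger_eq] at h
  simp only [timeDist, ← inner_testVec, neg_mul, integral_neg] at h
  have i1 := hθ.deriv.integrableOn_mul (locallyIntegrableOn_const_inner hI (testVec φ) hu)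
  have i2 := hθ.integrableOn_mul
    (locallyIntegrableOn_const_inner hI (testVec φ - hV.helmVec φ) hu)
  have i3 := hθ.integrableOn_mul (locallyIntegrableOn_const_inner hI (testVec φ) hF)
  have key : ∀ t, deriv θ t * inner ℂ (hV.helmVec φ) (hV.res (u t)) +
      θ t * inner ℂ (hV.helmVec φ) (hV.resRhs u F t) =
      deriv θ t * inner ℂ (testVec φ) (u t)
        + (-Complex.I) * (θ t * inner ℂ (testVec φ) (F t))
        + (Complex.I / 2) * (θ t * inner ℂ (testVec φ - hV.helmVec φ) (u t)) := by
    intro t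
    rw [resRhs, inner_smul_right, inner_sub_right, inner_smul_right, inner_sub_right,
      ← hV.inner_res, ← hV.inner_res, hV.res_helmVec, inner_sub_left]
    ring
  simp only [key]
  have s1 := integral_add (i1.add (i3.const_mul (-Complex.I))) (i2.const_mul (Complex.I / 2))
  have s2 := integral_add i1 (i3.const_mul (-Complex.I))
  simp only [Pi.add_apply] at s1
  rw [s1, s2, integral_const_mul, integral_const_mul]
  linear_combination Complex.I * h + (∫ t in I, deriv θ t * inner ℂ (testVec φ) (u t)) *
    (Complex.I_mul_I)

/-- The right-hand side of `i ∂ₜ (R v) = R G - ½ Δ_V R v - (i / t) R (x · ∇ v + v)`. -/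
def dilRhs (v G e : ℝ → L2) (t : ℝ) : L2 :=
  -Complex.I • (hV.res (G t) - (1 / 2 : ℂ) • (hV.res (v t) - v t)
    - (Complex.I * (t : ℂ)⁻¹) • hV.res (e t + v t))

theorem locallyIntegrableOn_dilRhs (hI : IsOpen I) (hI0 : I ⊆ Ioi 0) {v G e : ℝ → L2}
    (hv : LocallyIntegrableOn v I volume) (hG : LocallyIntegrableOn G I volume)
    (he : LocallyIntegrableOn e I volume) : LocallyIntegrableOn (hV.dilRhs v G e) I volume :=
  (((hV.res.locallyIntegrableOn_comp hG).sub
    (((hV.res.locallyIntegrableOn_comp hv).sub hv).smul (1 / 2 : ℂ))).sub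
    ((hV.res.locallyIntegrableOn_comp (he.add hv)).continuousOn_smul hI.isLocallyClosed
      (continuousOn_const.mul (continuousOn_ofReal_inv hI0)))).smul (-Complex.I)

/-- The equation for `v = M(t) u`, from the equation for `u`. -/
theorem isWeakDeriv_res_gaussOp (hI : IsOpen I) (hI0 : I ⊆ Ioi 0) {u F e : ℝ → L2}
    (hu : LocallyIntegrableOn u I volume) (hF : LocallyIntegrableOn F I volume)
    (he : LocallyIntegrableOn e I volume)
    (h : IsWeakDeriv I (fun t => hV.res (u t)) (hV.resRhs u F))
    (hue : ∀ᵐ t ∂(volume.restrict I), eulerDist (toDist (gaussOp t⁻¹ (u t))) = toDist (e t)) :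
    IsWeakDeriv I (fun t => hV.res (gaussOp t⁻¹ (u t)))
      (hV.dilRhs (fun t => gaussOp t⁻¹ (u t)) (fun t => gaussOp t⁻¹ (F t)) e) := by
  have hv := locallyIntegrableOn_gaussOp hI hu measurable_inv
  have hG := locallyIntegrableOn_gaussOp hI hF measurable_inv
  refine hV.isWeakDeriv_of_inner_helmVec (hV.res.locallyIntegrableOn_comp hv)
    (hV.locallyIntegrableOn_dilRhs hI hI0 hv hG he) fun ψ θ hθ => ?_
  have := separableSpace_L2
  -- The equation for `u` is tested with the moving vector `h_{M(t) ψ}`, which transfers the phase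
  -- from `u` to the test function.
  have hTD : ∫ t in I, (deriv θ t * inner ℂ (hV.helmVec (gaussS (1 * t⁻¹) ψ)) (hV.res (u t))
      + θ t * inner ℂ (deriv (fun r : ℝ => hV.helmVec (gaussS (1 * r⁻¹) ψ)) t) (hV.res (u t))
      + θ t * inner ℂ (hV.helmVec (gaussS (1 * t⁻¹) ψ)) (hV.resRhs u F t)) = 0 := h.integral_inner_eq_zero hI (hV.res.locallyIntegrableOn_comp hu)
    (hV.locallyIntegrableOn_resRhs hu hF) (hV.contDiffOn_inv_curve hI0 1 ψ) hθ
  refine Eq.trans (integral_congr_ae ?_) hTD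
  filter_upwards [ae_restrict_mem hI.measurableSet, hue] with t ht het
  have h1 : inner ℂ (testVec ψ) (e t) =
      -inner ℂ (testVec (eulerS ψ + ψ)) (gaussOp t⁻¹ (u t))
        - inner ℂ (testVec ψ) (gaussOp t⁻¹ (u t)) := by
    rw [inner_testVec, ← het, eulerDist_apply, inner_testVec, inner_testVec, two_smul, ← add_assoc,
      map_add, neg_add]
    ring
  rw [hV.inner_deriv_curve hI hI0 1 ψ ht]
  simp only [dilRhs, resRhs, inner_smul_right, inner_sub_right, inner_add_right, ← hV.inner_res,
    hV.res_helmVec]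
  -- The `|x|²` terms have coefficients `(i/2) t⁻²` from the moving phase and `-(i/2) t⁻²` from the
  -- conjugated Laplacian, so they cancel.
  simp only [hV.inner_helmVec_gaussS, inner_testVec_gaussS, one_mul, h1, Complex.ofReal_inv,
    Complex.ofReal_one]
  ring

end IsPotential

/-! ### The equation for `(-Δ_V)^(s/2) M(t) u` -/

theorem eulerDist_toDist_gaussS (τ : ℝ) (f : L2) (φ : 𝓢(Plane, ℂ)) :
    eulerDist (toDist f) (gaussS τ φ) =
      -inner ℂ (testVec (eulerS φ + φ)) (gaussOp τ f) - inner ℂ (testVec φ) (gaussOp τ f)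
        + Complex.I * τ * inner ℂ (testVec (normSqS φ)) (gaussOp τ f) := by
  rw [eulerDist_apply, eulerS_gaussS, ← map_smul (gaussS τ), ← map_add (gaussS τ),
    ← toDist_gaussOp, testVec_add, inner_add_left, inner_testVec, inner_testVec, inner_testVec]
  simp only [map_add, map_sub, map_smul, smul_eq_mul]
  ring

theorem integral_linear_combination {I : Set ℝ} {f₁ f₂ f₃ f₄ : ℝ → ℂ}
    (h₁ : IntegrableOn f₁ I volume) (h₂ : IntegrableOn f₂ I volume)
    (h₃ : IntegrableOn f₃ I volume) (h₄ : IntegrableOn f₄ I volume) (a b : ℂ) :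
    a * (∫ t in I, f₁ t) + b * (∫ t in I, f₂ t) - (∫ t in I, f₃ t) - ∫ t in I, f₄ t =
      ∫ t in I, (a * f₁ t + b * f₂ t - f₃ t - f₄ t) := by
  have e₁ := h₁.const_mul a
  have e₂ := h₂.const_mul b
  have e₃ : IntegrableOn (fun t => a * f₁ t + b * f₂ t) I volume := e₁.add e₂
  have e₄ : IntegrableOn (fun t => a * f₁ t + b * f₂ t - f₃ t) I volume := e₃.sub h₃
  rw [integral_sub e₄ h₄, integral_sub e₃ h₃, integral_add e₁ e₂, integral_const_mul,
    integral_const_mul]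

theorem contDiffOn_ofReal_rpow {I : Set ℝ} (hI0 : I ⊆ Ioi 0) (r : ℝ) :
    ContDiffOn ℝ ∞ (fun t : ℝ => ((t ^ r : ℝ) : ℂ)) I := by
  refine Complex.ofRealCLM.contDiff.comp_contDiffOn (f := fun t : ℝ => t ^ r) ?_
  exact contDiffOn_id.rpow_const_of_ne fun t ht => (hI0 ht).ne'

theorem continuousOn_I_mul_rpow {I : Set ℝ} (hI0 : I ⊆ Ioi 0) (r : ℝ) :
    ContinuousOn (fun t : ℝ => Complex.I * ((t ^ r : ℝ) : ℂ)) I :=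
  continuousOn_const.mul (contDiffOn_ofReal_rpow hI0 r).continuousOn

namespace IsPotential

variable {V : Plane → ℝ} {C : ℝ} (hV : IsPotential V C) {I : Set ℝ} {s : ℝ}

/-- The right-hand side of the equation for `R b`, where `b = (-Δ_V)^(s/2) v`. -/
def powRhs (b p q : ℝ → L2) (t : ℝ) : L2 :=
  -Complex.I • (p t - (1 / 2 : ℂ) • (hV.res (b t) - b t)
    - (Complex.I * (t : ℂ)⁻¹) • (q t + hV.res (b t)))

theorem locallyIntegrableOn_powRhs (hI : IsOpen I) (hI0 : I ⊆ Ioi 0) {b p q : ℝ → L2}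
    (hb : LocallyIntegrableOn b I volume) (hp : LocallyIntegrableOn p I volume)
    (hq : LocallyIntegrableOn q I volume) : LocallyIntegrableOn (hV.powRhs b p q) I volume :=
  ((hp.sub (((hV.res.locallyIntegrableOn_comp hb).sub hb).smul (1 / 2 : ℂ))).sub
    ((hq.add (hV.res.locallyIntegrableOn_comp hb)).continuousOn_smul hI.isLocallyClosed
      (continuousOn_const.mul (continuousOn_ofReal_inv hI0)))).smul (-Complex.I)

/-- Applying `(1 - R)^(s/2)` to the equation for `R v` turns each term `X` into `R^(s/2)` times its
image under `(-Δ_V)^(s/2)`; then the injective factor `R^(s/2)` is cancelled. -/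
theorem isWeakDeriv_res_pow (hI : IsOpen I) (hI0 : I ⊆ Ioi 0) (hs : 0 < s) {v G e b p q : ℝ → L2}
    (hv : LocallyIntegrableOn v I volume) (hG : LocallyIntegrableOn G I volume)
    (he : LocallyIntegrableOn e I volume) (hb : LocallyIntegrableOn b I volume)
    (hp : LocallyIntegrableOn p I volume) (hq : LocallyIntegrableOn q I volume)
    (h : IsWeakDeriv I (fun t => hV.res (v t)) (hV.dilRhs v G e))
    (hvb : ∀ᵐ t ∂(volume.restrict I), (v t, b t) ∈ (powV V s).graph)
    (hGp : ∀ᵐ t ∂(volume.restrict I), (hV.res (G t), p t) ∈ (powV V s).graph)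
    (heq : ∀ᵐ t ∂(volume.restrict I), (hV.res (e t), q t) ∈ (powV V s).graph) :
    IsWeakDeriv I (fun t => hV.res (b t)) (hV.powRhs b p q) := by
  have hR := hV.isResolvent
  have ha : 0 < s / 2 := by positivity
  refine IsWeakDeriv.of_map (hR.injective_cfcPow ha) (hV.res.locallyIntegrableOn_comp hb)
    (hV.locallyIntegrableOn_powRhs hI hI0 hb hp hq) ?_
  refine IsWeakDeriv.congr_ae (h.map (hV.res.locallyIntegrableOn_comp hv)
    (hV.locallyIntegrableOn_dilRhs hI hI0 hv hG he) (cfcCompl hV.res (s / 2))) ?_ ?_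
  · filter_upwards [hvb] with t ht
    rw [hR.cfc_apply_comm, hR.cfc_apply_comm, hR.cfcPow_of_mem_graph ha ht]
  · filter_upwards [hvb, hGp, heq] with t h1 h2 h3
    simp only [dilRhs, powRhs, map_smul, map_sub, map_add, hR.cfcPow_of_mem_graph ha h2,
      hR.cfcPow_of_mem_graph ha h3]
    rw [hR.cfc_apply_comm _ (b t), hR.cfcPow_of_mem_graph ha h1]
    simp only [hR.cfc_apply_comm]

/-- The pairing of `A(s) f` with a test function, in terms of `b = (-Δ_V)^(s/2) f` and
`q = (-Δ_V)^(s/2) (1 - Δ_V)⁻¹ (x · ∇ f)`. -/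
def pairA (s : ℝ) (b q : L2) (η : 𝓢(Plane, ℂ)) : ℂ :=
  s * toDist b η + eulerDist (toDist b) η - inner ℂ (hV.helmVec η) q

theorem locallyIntegrableOn_inner_curve (hI : IsOpen I) (hI0 : I ⊆ Ioi 0) {f : ℝ → L2}
    (hf : LocallyIntegrableOn f I volume) (φ : 𝓢(Plane, ℂ)) :
    LocallyIntegrableOn (fun t => inner ℂ (hV.helmVec (gaussS (-1 * t⁻¹) φ)) (f t)) I volume :=
  hf.inner_continuousOn hI (hV.contDiffOn_inv_curve hI0 (-1) φ).continuousOn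

theorem locallyIntegrableOn_pairA (hI : IsOpen I) (hI0 : I ⊆ Ioi 0) {b q : ℝ → L2}
    (hb : LocallyIntegrableOn b I volume) (hq : LocallyIntegrableOn q I volume)
    (φ : 𝓢(Plane, ℂ)) :
    LocallyIntegrableOn (fun t => hV.pairA s (b t) (q t) (gaussS (-1 * t⁻¹) φ)) I volume := by
  have hβ := locallyIntegrableOn_gaussOp hI hb
    (measurable_inv.const_mul (-1) : Measurable fun t : ℝ => -1 * t⁻¹)
  have h1 := fun ψ => locallyIntegrableOn_const_inner hI (testVec ψ) hβ
  have hc : ContinuousOn (fun t : ℝ => Complex.I * (-1 * (t : ℂ)⁻¹)) I :=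
    continuousOn_const.mul (continuousOn_const.mul (continuousOn_ofReal_inv hI0))
  have h2 := (h1 (normSqS φ)).continuousOn_mul hc hI.isLocallyClosed
  have h3 := ((((h1 φ).smul (s : ℂ)).add (((h1 (eulerS φ + φ)).neg.sub (h1 φ)).add h2))).sub
    (hV.locallyIntegrableOn_inner_curve hI hI0 hq φ)
  refine h3.congr (Filter.Eventually.of_forall fun t => ?_)
  simp only [pairA, eulerDist_toDist_gaussS, ← toDist_gaussOp, inner_testVec, Pi.add_apply,
    Pi.sub_apply, Pi.neg_apply, Pi.smul_apply, smul_eq_mul, Complex.ofReal_mul, Complex.ofReal_neg,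
    Complex.ofReal_one, Complex.ofReal_inv]

/-- The identity for the commutator in weak form. -/
theorem commutator_identity (hI : IsOpen I) (hI0 : I ⊆ Ioi 0) {b p q w : ℝ → L2}
    (hb : LocallyIntegrableOn b I volume) (hp : LocallyIntegrableOn p I volume)
    (hq : LocallyIntegrableOn q I volume) (hw : LocallyIntegrableOn w I volume)
    (hbw : ∀ t ∈ I, w t = ((t ^ s : ℝ) : ℂ) • gaussOp (-1 * t⁻¹) (b t))
    (h : IsWeakDeriv I (fun t => hV.res (b t)) (hV.powRhs b p q)) {θ : ℝ → ℂ}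
    (hθ : IsTimeTest I θ) (φ : 𝓢(Plane, ℂ)) :
    schrodinger V I w θ φ
      - (∫ t in I, θ t * (((t ^ s : ℝ) : ℂ) *
          inner ℂ (hV.helmVec (gaussS (-1 * t⁻¹) φ)) (p t)))
      = ∫ t in I, θ t * (Complex.I * ((t ^ (s - 1) : ℝ) : ℂ) *
          hV.pairA s (b t) (q t) (gaussS (-1 * t⁻¹) φ)) := by
  have := separableSpace_L2
  -- The factor `t ^ s` goes into the scalar test function; its derivative `s t ^ (s - 1)` supplies
  -- the term `s (-Δ_V)^(s/2)` of `A(s)`.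
  have hθs := hθ.mul_contDiffOn hI (contDiffOn_ofReal_rpow hI0 s)
  have hTD : ∫ t in I, (deriv (fun t => θ t * ((t ^ s : ℝ) : ℂ)) t *
        inner ℂ (hV.helmVec (gaussS (-1 * t⁻¹) φ)) (hV.res (b t))
      + θ t * ((t ^ s : ℝ) : ℂ) *
        inner ℂ (deriv (fun r : ℝ => hV.helmVec (gaussS (-1 * r⁻¹) φ)) t) (hV.res (b t))
      + θ t * ((t ^ s : ℝ) : ℂ) *
        inner ℂ (hV.helmVec (gaussS (-1 * t⁻¹) φ)) (hV.powRhs b p q t)) = 0 :=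
    h.integral_inner_eq_zero hI (hV.res.locallyIntegrableOn_comp hb)
      (hV.locallyIntegrableOn_powRhs hI hI0 hb hp hq) (hV.contDiffOn_inv_curve hI0 (-1) φ) hθs
  have i1 := hθ.deriv.integrableOn_mul (locallyIntegrableOn_const_inner hI (testVec φ) hw)
  have i2 := hθ.integrableOn_mul
    (locallyIntegrableOn_const_inner hI (testVec φ - hV.helmVec φ) hw)
  have i3 := hθ.integrableOn_mul ((hV.locallyIntegrableOn_inner_curve hI hI0 hp φ).continuousOn_mul
    (contDiffOn_ofReal_rpow hI0 s).continuousOn hI.isLocallyClosed)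
  have i4 := hθ.integrableOn_mul
    ((hV.locallyIntegrableOn_pairA (s := s) hI hI0 hb hq φ).continuousOn_mul
      (continuousOn_I_mul_rpow hI0 (s - 1)) hI.isLocallyClosed)
  have hneg : ∫ t in I, -deriv θ t * inner ℂ (testVec φ) (w t) =
      -∫ t in I, deriv θ t * inner ℂ (testVec φ) (w t) := by
    rw [← integral_neg]
    simp only [neg_mul]
  rw [hV.schrodinger_eq, ← sub_eq_zero, hneg, mul_neg, ← neg_mul]
  refine (integral_linear_combination i1 i2 i3 i4 (-Complex.I) (1 / 2)).trans ?_
  have hTD' := congrArg (fun z => -Complex.I * z) hTD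
  simp only [mul_zero] at hTD'
  rw [← integral_const_mul] at hTD'
  refine Eq.trans (setIntegral_congr_fun hI.measurableSet fun t ht => ?_) hTD'
  have ht0 : (0 : ℝ) < t := hI0 ht
  have htc : (t : ℂ) ≠ 0 := by exact_mod_cast ht0.ne'
  have hd : deriv (fun t => θ t * ((t ^ s : ℝ) : ℂ)) t =
      deriv θ t * ((t ^ s : ℝ) : ℂ) + θ t * (s * ((t ^ (s - 1) : ℝ) : ℂ)) := by
    have h1 : HasDerivAt θ (deriv θ t) t := (hθ.1.differentiable (by simp) t).hasDerivAt
    have h2 := (Real.hasDerivAt_rpow_const (x := t) (p := s) (Or.inl ht0.ne')).ofReal_comp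
    refine (h1.mul h2).deriv.trans ?_
    push_cast
    ring
  have hpow : ((t ^ s : ℝ) : ℂ) = ((t ^ (s - 1) : ℝ) : ℂ) * t := by
    rw [← Complex.ofReal_mul, Real.rpow_sub_one ht0.ne', div_mul_cancel₀ _ ht0.ne']
  beta_reduce
  rw [hd, hV.inner_deriv_curve hI hI0 (-1) φ ht, hbw t ht, pairA, eulerDist_toDist_gaussS,
    ← toDist_gaussOp, ← inner_testVec, hpow]
  simp only [powRhs, inner_smul_right, inner_sub_right, inner_add_right, ← hV.inner_res,
    hV.res_helmVec, inner_testVec_gaussS, inner_sub_left]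
  -- Only the pairing with `b` is expanded. Those with `p` and `q` stay as they are, since the
  -- extended powers on both sides are expressed by the same pairings.
  simp only [hV.inner_helmVec_gaussS _ _ (b t), Complex.ofReal_mul, Complex.ofReal_neg,
    Complex.ofReal_one, Complex.ofReal_inv]
  generalize inner ℂ (testVec φ) (gaussOp (-1 * t⁻¹) (b t)) = z₁
  generalize inner ℂ (testVec (eulerS φ + φ)) (gaussOp (-1 * t⁻¹) (b t)) = z₂
  generalize inner ℂ (hV.helmVec φ) (gaussOp (-1 * t⁻¹) (b t)) = z₃
  generalize inner ℂ (hV.helmVec (gaussS (-1 * t⁻¹) φ)) (q t) = z₄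
  generalize inner ℂ (hV.helmVec (gaussS (-1 * t⁻¹) φ)) (p t) = z₅
  have hi : Complex.I ^ 2 = -1 := Complex.I_sq
  field_simp
  linear_combination ((t ^ (s - 1) : ℝ) : ℂ) * θ t * (2 * t * Complex.I * (z₁ + z₂ + z₄)
    + t ^ 2 * (z₁ - z₃ - 2 * z₅)) * hi

end IsPotential

/-! ### The operators of the commutator identity in terms of their graphs -/

namespace IsPotential

variable {V : Plane → ℝ} {C s t : ℝ}

/-- Homogeneity of the power, with `(t²)^(s/2) = t^s` for `t > 0`. -/
theorem mem_graph_scaledPowV (hV : IsPotential V C) (hs : 0 < s) (ht : 0 < t) {f g : L2} :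
    (f, g) ∈ (scaledPowV V s t).graph ↔
      (f, ((t ^ s : ℝ) : ℂ)⁻¹ • g) ∈ (powV V s).graph := by
  have hts : (t ^ 2) ^ (s / 2) = t ^ s := by
    rw [← Real.rpow_natCast, ← Real.rpow_mul ht.le]
    congr 1
    push_cast
    ring
  have hne : ((t ^ s : ℝ) : ℂ) ≠ 0 := by exact_mod_cast (Real.rpow_pos_of_pos ht s).ne'
  rw [scaledPowV, hV.isResolvent.opPow_smul (by positivity) (by positivity), mem_graph_smul, hts]
  constructor
  · rintro ⟨a, ha, rfl⟩
    rwa [inv_smul_smul₀ hne]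
  · exact fun h => ⟨_, h, smul_inv_smul₀ hne g⟩

theorem mem_graph_JV (hV : IsPotential V C) (hs : 0 < s) (ht : 0 < t) {f g : L2} :
    (f, g) ∈ (JV V s t).graph ↔
      (gaussOp t⁻¹ f, ((t ^ s : ℝ) : ℂ)⁻¹ • gaussOp t⁻¹ g) ∈ (powV V s).graph := by
  simp only [JV, mem_graph_pComp, mem_graph_phaseOp, hV.mem_graph_scaledPowV hs ht, inv_neg]
  constructor
  · rintro ⟨k, ⟨_, rfl, hk⟩, rfl⟩
    rwa [gaussOp_gaussOp_neg]
  · exact fun h => ⟨_, ⟨_, rfl, h⟩, gaussOp_neg_gaussOp _ _⟩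

theorem pApply_JVDist (hV : IsPotential V C) (hs : 0 < s) (ht : 0 < t) {f g : L2}
    (h : (hV.res (gaussOp t⁻¹ f), g) ∈ (powV V s).graph) (φ : 𝓢(Plane, ℂ)) :
    pApply (JVDist V s t) f φ =
      ((t ^ s : ℝ) : ℂ) * inner ℂ (hV.helmVec (gaussS (-1 * t⁻¹) φ)) g := by
  have hne : ((t ^ s : ℝ) : ℂ) ≠ 0 := by exact_mod_cast (Real.rpow_pos_of_pos ht s).ne'
  have hg : (hV.res (gaussOp t⁻¹ f), ((t ^ s : ℝ) : ℂ) • g) ∈ (scaledPowV V s t).graph := by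
    rwa [hV.mem_graph_scaledPowV hs ht, inv_smul_smul₀ hne]
  have h1 := mem_graph_compPMap (D := phaseDist (-t)).2 ⟨_, mem_graph_pComp.2
    ⟨_, mem_graph_phaseOp.2 rfl, hV.mem_graph_extendV.2 ⟨_, hg, rfl⟩⟩, rfl⟩
  rw [JVDist, pApply_of_mem_graph h1, phaseDist_apply, ← hV.inner_helmVec, inner_smul_right,
    inv_neg, neg_one_mul]

theorem pApply_MAM (hV : IsPotential V C) {f b e q : L2} (hb : (gaussOp t⁻¹ f, b) ∈ (powV V s).graph)
    (he : (gaussOp t⁻¹ f, e) ∈ euler.graph) (hq : (hV.res e, q) ∈ (powV V s).graph)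
    (φ : 𝓢(Plane, ℂ)) :
    pApply (MAM V s t) f φ = hV.pairA s b q (gaussS (-1 * t⁻¹) φ) := by
  have h1 := mem_graph_add.2 ⟨_, _, mem_graph_smul (c := (s : ℂ)).2
    ⟨_, mem_graph_compPMap (D := toDist).2 ⟨_, hb, rfl⟩, rfl⟩,
    mem_graph_sub.2 ⟨_, _, mem_graph_compPMap (D := eulerDist ∘ₗ toDist).2 ⟨_, hb, rfl⟩,
      mem_graph_pComp.2 ⟨_, he, hV.mem_graph_extendV.2 ⟨_, hq, rfl⟩⟩, rfl⟩, rfl⟩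
  have h2 := mem_graph_compPMap (D := phaseDist (-t)).2 ⟨_, mem_graph_pComp.2
    ⟨_, mem_graph_phaseOp.2 rfl, h1⟩, rfl⟩
  rw [MAM, opA, pApply_of_mem_graph h2, phaseDist_apply, pairA, hV.inner_helmVec, inv_neg,
    neg_one_mul, add_sub_assoc]
  rfl

end IsPotential

/-! ### The theorem -/

theorem isPotential_of_decay {V : Plane → ℝ} (hV : Continuous V) {c β : ℝ} (hβ : 0 ≤ β)
    (hdecay : ∀ x, |V x| ≤ c / (Real.sqrt (1 + ‖x‖ ^ 2)) ^ β) (hc : 0 ≤ c) (hpos : ∀ x, 0 ≤ V x) :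
    IsPotential V c where
  aestronglyMeasurable := (Complex.continuous_ofReal.comp hV).aestronglyMeasurable
  norm_le x := by
    rw [Complex.norm_real, Real.norm_eq_abs]
    refine (hdecay x).trans (div_le_self hc (Real.one_le_rpow ?_ hβ))
    rw [Real.one_le_sqrt]
    nlinarith [sq_nonneg ‖x‖]
  nonneg := hpos

end

theorem proposition2p1 (V : Plane → ℝ) (hV : ContDiff ℝ 1 V)
    (hdecay : ∃ c > (0 : ℝ), ∃ β > (3 : ℝ), ∀ x : Plane,
      |V x| + |fderiv ℝ V x x| ≤ c / (Real.sqrt (1 + ‖x‖ ^ 2)) ^ β)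
    (hpos : ∀ x, 0 ≤ V x)
    (s : ℝ) (hs : 0 < s)
    (I : Set ℝ) (hI : IsOpen I) (hIpos : I ⊆ Ioi 0)
    -- `u` and `F = (i ∂_t + ½ Δ_V) u` are in `L¹_loc(I; L²)`
    (u F : ℝ → L2) (hu : LocallyIntegrableOn u I volume) (hF : LocallyIntegrableOn F I volume)
    (huF : ∀ θ, IsTimeTest I θ → ∀ φ : 𝓢(Plane, ℂ),
      schrodinger V I u θ φ = timeDist I (fun t => toDist (F t)) θ φ)
    -- `|J_V|^s u` is in `L¹_loc(I; L²)`
    (hJu : LocIntDomain I (fun t => JV V s t) u)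
    -- `|J_V|^s F` is defined
    (hJF : LocIntDomain I (fun t => pComp (scaledPowV V s t) (pComp (resV V) (phaseOp t))) F)
    -- `x · ∇ M(t) u` is in `L¹_loc(I; L²)`
    (hxu : LocIntDomain I (fun t => pComp euler (phaseOp t)) u)
    -- `(-Δ_V)^(s/2) (x · ∇) M(t) u` is defined
    (hAu : LocIntDomain I
      (fun t => pComp (powV V s) (pComp (resV V) (pComp euler (phaseOp t)))) u) :
    IsLocInt I (fun t => pApply (JVDist V s t) (F t)) ∧
    IsLocInt I (fun t => (Complex.I * ((t ^ (s - 1) : ℝ) : ℂ)) • pApply (MAM V s t) (u t)) ∧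
    ∀ θ, IsTimeTest I θ → ∀ φ : 𝓢(Plane, ℂ),
      schrodinger V I (fun t => pApply (JV V s t) (u t)) θ φ
          - timeDist I (fun t => pApply (JVDist V s t) (F t)) θ φ
        = timeDist I
            (fun t => (Complex.I * ((t ^ (s - 1) : ℝ) : ℂ)) • pApply (MAM V s t) (u t)) θ φ := by
  obtain ⟨c, hc, β, hβ, hb⟩ := hdecay
  have hP : IsPotential V c := isPotential_of_decay hV.continuous (by linarith)
    (fun x => (le_add_of_nonneg_right (abs_nonneg _)).trans (hb x)) hc.le hpos
  obtain ⟨hJu, hw⟩ := hJu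
  obtain ⟨hJF, hP'⟩ := hJF
  obtain ⟨hxu, he⟩ := hxu
  obtain ⟨hAu, hq⟩ := hAu
  set w : ℝ → L2 := fun t => pApply (JV V s t) (u t) with hw_def
  set P : ℝ → L2 := fun t =>
    pApply (pComp (scaledPowV V s t) (pComp (resV V) (phaseOp t))) (F t) with hP_def
  set e : ℝ → L2 := fun t => pApply (pComp euler (phaseOp t)) (u t) with he_def
  set q : ℝ → L2 := fun t =>
    pApply (pComp (powV V s) (pComp (resV V) (pComp euler (phaseOp t)))) (u t) with hq_def
  -- Undoing the phase and the scaling gives `b = (-Δ_V)^(s/2) M(t) u` and `p = (-Δ_V)^(s/2) (1 -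
  -- Δ_V)⁻¹ M(t) F` almost everywhere. Defined this way they inherit local integrability from `w`
  -- and `P`.
  set b : ℝ → L2 := fun t => ((t ^ s : ℝ) : ℂ)⁻¹ • gaussOp t⁻¹ (w t) with hb_def
  set p : ℝ → L2 := fun t => ((t ^ s : ℝ) : ℂ)⁻¹ • P t with hp_def
  have hne : ∀ t ∈ I, ((t ^ s : ℝ) : ℂ) ≠ 0 := fun t ht => by
    exact_mod_cast (Real.rpow_pos_of_pos (hIpos ht) s).ne'
  have hcont : ContinuousOn (fun t : ℝ => ((t ^ s : ℝ) : ℂ)⁻¹) I :=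
    (contDiffOn_ofReal_rpow hIpos s).continuousOn.inv₀ hne
  have hbl : LocallyIntegrableOn b I volume :=
    (locallyIntegrableOn_gaussOp hI hw measurable_inv).continuousOn_smul hI.isLocallyClosed hcont
  have hpl : LocallyIntegrableOn p I volume := hP'.continuousOn_smul hI.isLocallyClosed hcont
  have hI_ae := ae_restrict_mem (μ := (volume : Measure ℝ)) hI.measurableSet
  have gb : ∀ᵐ t ∂(volume.restrict I), (gaussOp t⁻¹ (u t), b t) ∈ (powV V s).graph := by
    filter_upwards [hI_ae, hJu] with t ht h
    exact (hP.mem_graph_JV hs (hIpos ht)).1 (mem_graph_pApply h)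
  have gp : ∀ᵐ t ∂(volume.restrict I),
      (hP.res (gaussOp t⁻¹ (F t)), p t) ∈ (powV V s).graph := by
    filter_upwards [hI_ae, hJF] with t ht h
    obtain ⟨g, h1, h2⟩ := mem_graph_pComp.1 (mem_graph_pApply h)
    obtain ⟨k, h3, h4⟩ := mem_graph_pComp.1 h1
    rw [mem_graph_phaseOp.1 h3, hP.mem_graph_resV.1 h4]
    exact (hP.mem_graph_scaledPowV hs (hIpos ht)).1 h2
  have ge : ∀ᵐ t ∂(volume.restrict I), (gaussOp t⁻¹ (u t), e t) ∈ euler.graph := by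
    filter_upwards [hxu] with t h
    obtain ⟨g, h1, h2⟩ := mem_graph_pComp.1 (mem_graph_pApply h)
    rw [mem_graph_phaseOp.1 h1]
    exact h2
  have gq : ∀ᵐ t ∂(volume.restrict I), (hP.res (e t), q t) ∈ (powV V s).graph := by
    filter_upwards [hxu, hAu] with t h h'
    obtain ⟨g, h1, h2⟩ := mem_graph_pComp.1 (mem_graph_pApply h')
    obtain ⟨k, h3, h4⟩ := mem_graph_pComp.1 h1
    have h5 : e t = k := pApply_of_mem_graph h3
    rw [h5, hP.mem_graph_resV.1 h4]
    exact h2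
  have hJ : ∀ φ, ∀ᵐ t ∂(volume.restrict I), pApply (JVDist V s t) (F t) φ =
      ((t ^ s : ℝ) : ℂ) * inner ℂ (hP.helmVec (gaussS (-1 * t⁻¹) φ)) (p t) := by
    intro φ
    filter_upwards [hI_ae, gp] with t ht h
    exact hP.pApply_JVDist hs (hIpos ht) h φ
  have hM : ∀ φ, ∀ᵐ t ∂(volume.restrict I),
      ((Complex.I * ((t ^ (s - 1) : ℝ) : ℂ)) • pApply (MAM V s t) (u t)) φ =
      Complex.I * ((t ^ (s - 1) : ℝ) : ℂ) *
        hP.pairA s (b t) (q t) (gaussS (-1 * t⁻¹) φ) := by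
    intro φ
    filter_upwards [gb, ge, gq] with t h1 h2 h3
    rw [← hP.pApply_MAM h1 h2 h3]
    rfl
  have hweak := hP.isWeakDeriv_res_pow hI hIpos hs
    (locallyIntegrableOn_gaussOp hI hu measurable_inv)
    (locallyIntegrableOn_gaussOp hI hF measurable_inv) he hbl hpl hq
    (hP.isWeakDeriv_res_gaussOp hI hIpos hu hF he (hP.isWeakDeriv_res hI hu hF huF)
      (ge.mono fun t h => mem_graph_l2Part.1 h)) gb gp gq
  refine ⟨fun φ => ?_, fun φ => ?_, fun θ hθ φ => ?_⟩
  · exact ((hP.locallyIntegrableOn_inner_curve hI hIpos hpl φ).continuousOn_mul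
      (contDiffOn_ofReal_rpow hIpos s).continuousOn hI.isLocallyClosed).congr
        ((hJ φ).mono fun t h => h.symm)
  · exact ((hP.locallyIntegrableOn_pairA hI hIpos hbl hq φ).continuousOn_mul
      (continuousOn_I_mul_rpow hIpos (s - 1)) hI.isLocallyClosed).congr
        ((hM φ).mono fun t h => h.symm)
  · have h1 : timeDist I (fun t => pApply (JVDist V s t) (F t)) θ φ = ∫ t in I, θ t *
        (((t ^ s : ℝ) : ℂ) * inner ℂ (hP.helmVec (gaussS (-1 * t⁻¹) φ)) (p t)) :=
      integral_congr_ae ((hJ φ).mono fun t h => congrArg (θ t * ·) h)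
    have h2 : timeDist I
        (fun t => (Complex.I * ((t ^ (s - 1) : ℝ) : ℂ)) • pApply (MAM V s t) (u t)) θ φ =
        ∫ t in I, θ t * (Complex.I * ((t ^ (s - 1) : ℝ) : ℂ) *
          hP.pairA s (b t) (q t) (gaussS (-1 * t⁻¹) φ)) :=
      integral_congr_ae ((hM φ).mono fun t h => congrArg (θ t * ·) h)
    rw [h1, h2]
    -- The relation `w = t^s M(-t) b` holds at every `t ∈ I`, by the definition of `b`.
    refine hP.commutator_identity hI hIpos hbl hpl hq hw (fun t ht => ?_) hweak hθ φ
    rw [hb_def]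
    simp only [map_smul]
    rw [neg_one_mul, gaussOp_neg_gaussOp, smul_inv_smul₀ (hne t ht)]
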